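/- Propositional formulas are built from atoms and $\bot$ by $\lor,\land,\supset$. A cedent is a finite set of formulas, and a sequent $\Gamma\Rightarrow\alpha$ consists of a cedent $\Gamma$ and a formula $\alpha$; $\alpha,\Gamma$ denotes $\{\alpha\}\cup\Gamma$ and $\Gamma,\Delta$ denotes $\Gamma\cup\Delta$. The natural deduction system $\mathsf{NJp}$ has the axioms $\alpha,\Gamma\Rightarrow\alpha$ for any $\alpha$ and $\bot,\Gamma\Rightarrow p$ for atoms $p$, and the following rules ($i=0,1$): $(\lor I)$ from $\Gamma\Rightarrow\alpha_i$ infer $\Gamma\Rightarrow\alpha_0\lor\alpha_1$; $(\lor E)$ from $\Gamma\Rightarrow\alpha_0\lor\alpha_1$, $\alpha_0,\Gamma\Rightarrow\beta$ and $\alpha_1,\Gamma\Rightarrow\beta$ infer $\Gamma\Rightarrow\beta$; $(\land I)$ from $\Gamma\Rightarrow\alpha_0$ and $\Gamma\Rightarrow\alpha_1$ infer $\Gamma\Rightarrow\alpha_0\land\alpha_1$; $(\land E)$ from $\Gamma\Rightarrow\alpha_0\land\alpha_1$ infer $\Gamma\Rightarrow\alpha_i$; $(\supset I)$ from $\alpha,\Gamma\Rightarrow\beta$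 infer $\Gamma\Rightarrow\alpha\supset\beta$; $(\supset E)$ from $\Gamma\Rightarrow\alpha\supset\beta$ and $\Gamma\Rightarrow\alpha$ infer $\Gamma\Rightarrow\beta$. Derivations are finite trees. The strictly positive subformula occurrences of a formula $\alpha$ are $\alpha$ itself, and those of $\alpha_0$ and of $\alpha_1$ if $\alpha$ is $\alpha_0\lor\alpha_1$ or $\alpha_0\land\alpha_1$, and those of $\alpha_1$ if $\alpha$ is $\alpha_0\supset\alpha_1$. A formula is Harrop if no disjunction occurs strictly positively in it, and a cedent is Harrop if all its members are Harrop formulas. A $(cut)$-deduction from a finite set $\mathcal S$ of sequents is a finite tree whose initial sequents belong to $\mathcal S$ and all of whose inferences are of the form: from $\Gamma\Rightarrow\beta$ and $\beta,\Delta\Rightarrow\alpha$ infer $\Gamma,\Delta\Rightarrow\alpha$. **Theorem.** There is a polynomial-time algorithm (a Turing machine working on written derivations, with running time bounded by a polynomial in the length of the input) which, given an $\mathsf{NJp}$-derivation $d$ of a sequent $\Gamma\Rightarrow\alpha_0\lor\alpha_1$ with Harrop antecedent $\Gamma$, outputs an $i\in\{0,1\}$ and a $(cut)$-deduction, from the set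 of sequents occurring in $d$, of a sequent $\Gamma'\Rightarrow\alpha_i$ with $\Gamma'\subseteq\Gamma$. -/

import Mathlib

namespace NJp

/-- Propositional formulas over the atoms `p₀, p₁, …` and the connectives `⊥, ∨, ∧, ⊃`. -/
inductive Formula : Type
  | atom (n : ℕ)
  | bot
  | or (α β : Formula)
  | and (α β : Formula)
  | imp (α β : Formula)
  deriving DecidableEq

/-- `StrictlyPositive β α`: the formula `β` has a strictly positive occurrence in `α`. -/
inductive StrictlyPositive (β : Formula) : Formula → Prop
  | refl : StrictlyPositive β β
  | or_left {α₀ α₁ : Formula} : StrictlyPositive β α₀ → StrictlyPositive β (.or α₀ α₁)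
  | or_right {α₀ α₁ : Formula} : StrictlyPositive β α₁ → StrictlyPositive β (.or α₀ α₁)
  | and_left {α₀ α₁ : Formula} : StrictlyPositive β α₀ → StrictlyPositive β (.and α₀ α₁)
  | and_right {α₀ α₁ : Formula} : StrictlyPositive β α₁ → StrictlyPositive β (.and α₀ α₁)
  | imp_right {α₀ α₁ : Formula} : StrictlyPositive β α₁ → StrictlyPositive β (.imp α₀ α₁)

/-- A formula is Harrop if no disjunction occurs strictly positively in it. -/
def Formula.IsHarrop (α : Formula) : Prop :=
  ∀ β γ : Formula, ¬ StrictlyPositive (.or β γ) α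

/-- Cedents are finite sets of formulas. -/
abbrev Cedent : Type := Finset Formula

/-- A cedent is Harrop if all its members are Harrop formulas. -/
def Cedent.IsHarrop (Γ : Cedent) : Prop :=
  ∀ α ∈ Γ, α.IsHarrop

/-- Sequents `Γ ⇒ α`. -/
structure Sequent : Type where
  ante : Cedent
  succ : Formula
  deriving DecidableEq

/-- Natural deduction derivations (trees) of a sequent. Writing `α, Γ` for `insert α Γ`, the
axioms are `Γ ⇒ α` with `α ∈ Γ`, and `Γ ⇒ p` with `⊥ ∈ Γ` and `p` an atom. -/
inductive Derivation : Sequent → Type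
  | ax {Γ : Cedent} {α : Formula} (h : α ∈ Γ) : Derivation ⟨Γ, α⟩
  | botAx {Γ : Cedent} {n : ℕ} (h : Formula.bot ∈ Γ) : Derivation ⟨Γ, .atom n⟩
  | orE {Γ : Cedent} {α₀ α₁ β : Formula} : Derivation ⟨Γ, .or α₀ α₁⟩ →
      Derivation ⟨insert α₀ Γ, β⟩ → Derivation ⟨insert α₁ Γ, β⟩ → Derivation ⟨Γ, β⟩
  | orI₀ {Γ : Cedent} {α₀ α₁ : Formula} : Derivation ⟨Γ, α₀⟩ → Derivation ⟨Γ, .or α₀ α₁⟩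
  | orI₁ {Γ : Cedent} {α₀ α₁ : Formula} : Derivation ⟨Γ, α₁⟩ → Derivation ⟨Γ, .or α₀ α₁⟩
  | andE₀ {Γ : Cedent} {α₀ α₁ : Formula} : Derivation ⟨Γ, .and α₀ α₁⟩ → Derivation ⟨Γ, α₀⟩
  | andE₁ {Γ : Cedent} {α₀ α₁ : Formula} : Derivation ⟨Γ, .and α₀ α₁⟩ → Derivation ⟨Γ, α₁⟩
  | andI {Γ : Cedent} {α₀ α₁ : Formula} : Derivation ⟨Γ, α₀⟩ → Derivation ⟨Γ, α₁⟩ →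
      Derivation ⟨Γ, .and α₀ α₁⟩
  | impE {Γ : Cedent} {α β : Formula} : Derivation ⟨Γ, .imp α β⟩ → Derivation ⟨Γ, α⟩ →
      Derivation ⟨Γ, β⟩
  | impI {Γ : Cedent} {α β : Formula} : Derivation ⟨insert α Γ, β⟩ → Derivation ⟨Γ, .imp α β⟩

/-- The finite set of sequents occurring in a derivation. -/
def Derivation.sequents : {s : Sequent} → Derivation s → Finset Sequent
  | _, .ax (Γ := Γ) (α := α) _ => {⟨Γ, α⟩}
  | _, .botAx (Γ := Γ) (n := n) _ => {⟨Γ, .atom n⟩}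
  | _, .orE (Γ := Γ) (β := β) d d₀ d₁ =>
      insert ⟨Γ, β⟩ (d.sequents ∪ d₀.sequents ∪ d₁.sequents)
  | _, .orI₀ (Γ := Γ) (α₀ := α₀) (α₁ := α₁) d => insert ⟨Γ, .or α₀ α₁⟩ d.sequents
  | _, .orI₁ (Γ := Γ) (α₀ := α₀) (α₁ := α₁) d => insert ⟨Γ, .or α₀ α₁⟩ d.sequents
  | _, .andE₀ (Γ := Γ) (α₀ := α₀) d => insert ⟨Γ, α₀⟩ d.sequents
  | _, .andE₁ (Γ := Γ) (α₁ := α₁) d => insert ⟨Γ, α₁⟩ d.sequents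
  | _, .andI (Γ := Γ) (α₀ := α₀) (α₁ := α₁) d₀ d₁ =>
      insert ⟨Γ, .and α₀ α₁⟩ (d₀.sequents ∪ d₁.sequents)
  | _, .impE (Γ := Γ) (β := β) d₀ d₁ => insert ⟨Γ, β⟩ (d₀.sequents ∪ d₁.sequents)
  | _, .impI (Γ := Γ) (α := α) (β := β) d => insert ⟨Γ, .imp α β⟩ d.sequents

/-- Deductions (trees) starting from sequents in `S`, all of whose inferences are cuts: from
`Γ ⇒ β` and `β, Δ ⇒ α` infer `Γ, Δ ⇒ α`. -/
inductive CutDeduction (S : Finset Sequent) : Sequent → Type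
  | init {s : Sequent} (h : s ∈ S) : CutDeduction S s
  | cut {Γ Δ : Cedent} {α β : Formula} : CutDeduction S ⟨Γ, β⟩ →
      CutDeduction S ⟨insert β Δ, α⟩ → CutDeduction S ⟨Γ ∪ Δ, α⟩

/-! ### Writing the objects as strings over a finite alphabet -/

/-- The alphabet: binary digits, the symbols of formulas, the comma and the arrow of sequents,
and one name for each axiom and inference rule. -/
inductive Symbol : Type
  | zero | one
  | atom | bot | or | and | imp
  | comma | arrow
  | ruleAx | ruleBotAx | ruleOrE | ruleOrI₀ | ruleOrI₁ | ruleAndE₀ | ruleAndE₁ | ruleAndI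
  | ruleImpE | ruleImpI
  | ruleInit | ruleCut
  deriving DecidableEq

/-- Binary digits. -/
def Symbol.ofBool : Bool → Symbol
  | false => .zero
  | true => .one

/-- Formulas in Polish notation; the atom `pₙ` is the binary expansion of `n` (least significant
digit first) closed by the symbol `atom`. -/
def Formula.code : Formula → List Symbol
  | .atom n => n.bits.map Symbol.ofBool ++ [.atom]
  | .bot => [.bot]
  | .or α β => .or :: (α.code ++ β.code)
  | .and α β => .and :: (α.code ++ β.code)
  | .imp α β => .imp :: (α.code ++ β.code)

/-- `w` is a way of writing the sequent `Γ ⇒ α`: a list of the elements of `Γ`, in any order and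
possibly with repetitions, each closed by a comma, then the arrow, then `α`. -/
def Sequent.IsCode (s : Sequent) (w : List Symbol) : Prop :=
  ∃ l : List Formula, l.toFinset = s.ante ∧
    w = l.flatMap (fun α => α.code ++ [.comma]) ++ [.arrow] ++ s.succ.code

/-- `w` is a way of writing the derivation: the name of the last rule, then the end sequent, then
the immediate subderivations from left to right. -/
def Derivation.IsCode : {s : Sequent} → Derivation s → List Symbol → Prop
  | _, .ax (Γ := Γ) (α := α) _, w => ∃ u, Sequent.IsCode ⟨Γ, α⟩ u ∧ w = .ruleAx :: u
  | _, .botAx (Γ := Γ) (n := n) _, w => ∃ u, Sequent.IsCode ⟨Γ, .atom n⟩ u ∧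
      w = .ruleBotAx :: u
  | _, .orE (Γ := Γ) (β := β) d d₀ d₁, w => ∃ u v v₀ v₁, Sequent.IsCode ⟨Γ, β⟩ u ∧
      d.IsCode v ∧ d₀.IsCode v₀ ∧ d₁.IsCode v₁ ∧ w = .ruleOrE :: (u ++ v ++ v₀ ++ v₁)
  | _, .orI₀ (Γ := Γ) (α₀ := α₀) (α₁ := α₁) d, w => ∃ u v, Sequent.IsCode ⟨Γ, .or α₀ α₁⟩ u ∧
      d.IsCode v ∧ w = .ruleOrI₀ :: (u ++ v)
  | _, .orI₁ (Γ := Γ) (α₀ := α₀) (α₁ := α₁) d, w => ∃ u v, Sequent.IsCode ⟨Γ, .or α₀ α₁⟩ u ∧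
      d.IsCode v ∧ w = .ruleOrI₁ :: (u ++ v)
  | _, .andE₀ (Γ := Γ) (α₀ := α₀) d, w => ∃ u v, Sequent.IsCode ⟨Γ, α₀⟩ u ∧
      d.IsCode v ∧ w = .ruleAndE₀ :: (u ++ v)
  | _, .andE₁ (Γ := Γ) (α₁ := α₁) d, w => ∃ u v, Sequent.IsCode ⟨Γ, α₁⟩ u ∧
      d.IsCode v ∧ w = .ruleAndE₁ :: (u ++ v)
  | _, .andI (Γ := Γ) (α₀ := α₀) (α₁ := α₁) d₀ d₁, w => ∃ u v₀ v₁,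
      Sequent.IsCode ⟨Γ, .and α₀ α₁⟩ u ∧ d₀.IsCode v₀ ∧ d₁.IsCode v₁ ∧
      w = .ruleAndI :: (u ++ v₀ ++ v₁)
  | _, .impE (Γ := Γ) (β := β) d₀ d₁, w => ∃ u v₀ v₁, Sequent.IsCode ⟨Γ, β⟩ u ∧
      d₀.IsCode v₀ ∧ d₁.IsCode v₁ ∧ w = .ruleImpE :: (u ++ v₀ ++ v₁)
  | _, .impI (Γ := Γ) (α := α) (β := β) d, w => ∃ u v, Sequent.IsCode ⟨Γ, .imp α β⟩ u ∧
      d.IsCode v ∧ w = .ruleImpI :: (u ++ v)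

/-- `w` is a way of writing the cut-deduction, in the same format as for derivations. -/
def CutDeduction.IsCode {S : Finset Sequent} :
    {s : Sequent} → CutDeduction S s → List Symbol → Prop
  | _, .init (s := s) _, w => ∃ u, s.IsCode u ∧ w = .ruleInit :: u
  | _, .cut (Γ := Γ) (Δ := Δ) (α := α) c₀ c₁, w => ∃ u v₀ v₁,
      Sequent.IsCode ⟨Γ ∪ Δ, α⟩ u ∧ c₀.IsCode v₀ ∧ c₁.IsCode v₁ ∧ w = .ruleCut :: (u ++ v₀ ++ v₁)

/-- `w` is an admissible input: it writes a derivation of some sequent `Γ ⇒ α₀ ∨ α₁` with Harrop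
antecedent `Γ`. -/
def IsInput (w : List Symbol) : Prop :=
  ∃ (Γ : Cedent) (α : Fin 2 → Formula) (d : Derivation ⟨Γ, .or (α 0) (α 1)⟩),
    Γ.IsHarrop ∧ d.IsCode w

end NJp

/-! Read each sequent of the derivation `d` as a Horn clause: once every formula of its antecedent
is known, its succedent becomes known. Start from `Γ` and close off; let `T` be the set of
succedents obtained. Relative to `T` there is a slash in the style of Aczel, in which a disjunction
holds only if one disjunct lies in `T` and is itself slashed. Every Harrop formula is slashed
whatever `T` is (`Formula.IsHarrop.slash`), and because `T` is closed under the sequents of `d`,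
every rule of `d` preserves the slash (`Derivation.slash`). The end formula is therefore slashed, so
some disjunct is in `T`, and no normalization of `d` is needed.

The closure is computed by repeated passes through the list of sequents. A pass that starts
unsaturated yields a new succedent, so more passes than sequents suffice (`saturated_passes`).
Activated sequents are recorded with the latest in front, so each antecedent is known from `Γ` and
the sequents behind it (`Grounded`). Starting from a sequent that proves a disjunct and running back
through this list, each activated sequent is cut in at most once, until only formulas of `Γ` remain
on the left (`cutAll_correct`).

For the machine, the tree shape of `d` is irrelevant: its string is a list of sequents, each
introduced by a rule name (`Derivation.IsCode.exists_list`). Being known is a search for a formula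
string after an arrow (`occurs_stackCode`). With input length `n`, the activated list grows by at
most `n` per pass and stays within `n * n + n`, whence a polynomial bound (`StackProg.runs_main`).
The algorithm is a structured stack program, compiled to a `TM2` machine step for step
(`Exec.simulation`). -/

namespace NJp

open Function

/-! ### Structured stack programs -/

/-- Structured programs acting on finitely many stacks. Tests and pushed symbols depend on the
tops of the stacks. -/
inductive StackProg (K A : Type) : Type
  | skip
  | push (k : K) (f : (K → Option A) → A)
  | pop (k : K)
  | seq (p q : StackProg K A)
  | ite (c : (K → Option A) → Bool) (p q : StackProg K A)
  | loop (c : (K → Option A) → Bool) (p : StackProg K A)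

namespace StackProg

variable {K A : Type}

/-- The tops of the stacks. -/
def tops (S : K → List A) : K → Option A := fun k => (S k).head?

variable [DecidableEq K]

/-- `Exec p S S' n`: started on the stacks `S`, the program `p` halts after `n` steps with the
stacks `S'`. -/
inductive Exec : StackProg K A → (K → List A) → (K → List A) → ℕ → Prop
  | skip {S} : Exec .skip S S 1
  | push {k f S} : Exec (.push k f) S (update S k (f (tops S) :: S k)) 1
  | pop {k S} : Exec (.pop k) S (update S k (S k).tail) 1
  | seq {p q S S' S'' m n} : Exec p S S' m → Exec q S' S'' n → Exec (.seq p q) S S'' (m + n)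
  | ite_true {c p q S S' n} : c (tops S) = true → Exec p S S' n → Exec (.ite c p q) S S' (n + 1)
  | ite_false {c p q S S' n} : c (tops S) = false → Exec q S S' n → Exec (.ite c p q) S S' (n + 1)
  | loop_true {c p S S' S'' m n} : c (tops S) = true → Exec p S S' m →
      Exec (.loop c p) S' S'' n → Exec (.loop c p) S S'' (m + n + 1)
  | loop_false {c p S} : c (tops S) = false → Exec (.loop c p) S S 1

/-- Needed at the very end: the output function is chosen from the existence of a run, and
determinism identifies it with the output found for any derivation written by the same string. -/
theorem Exec.deterministic {p : StackProg K A} {S S' : K → List A} {n : ℕ} (h : Exec p S S' n) :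
    ∀ {S'' : K → List A} {m : ℕ}, Exec p S S'' m → S' = S'' := by
  induction h with
  | skip => intro _ _ h; cases h; rfl
  | push => intro _ _ h; cases h; rfl
  | pop => intro _ _ h; cases h; rfl
  | seq _ _ ih₁ ih₂ =>
    intro _ _ h
    cases h with
    | seq h₁ h₂ => obtain rfl := ih₁ h₁; exact ih₂ h₂
  | ite_true hc _ ih =>
    intro _ _ h
    cases h with
    | ite_true _ h => exact ih h
    | ite_false hc' _ => simp [hc] at hc'
  | ite_false hc _ ih =>
    intro _ _ h
    cases h with
    | ite_true hc' _ => simp [hc] at hc'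
    | ite_false _ h => exact ih h
  | loop_true hc _ _ ih₁ ih₂ =>
    intro _ _ h
    cases h with
    | loop_true _ h₁ h₂ => obtain rfl := ih₁ h₁; exact ih₂ h₂
    | loop_false hc' => simp [hc] at hc'
  | loop_false hc =>
    intro _ _ h
    cases h with
    | loop_true hc' _ _ => simp [hc] at hc'
    | loop_false _ => rfl

/-- `Runs p S S' n`: started on `S`, the program `p` halts with `S'` after at most `n` steps. -/
def Runs (p : StackProg K A) (S S' : K → List A) (n : ℕ) : Prop :=
  ∃ m ≤ n, Exec p S S' m

namespace Runs

variable {p q : StackProg K A} {c : (K → Option A) → Bool} {S S' S'' : K → List A} {m n : ℕ}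

theorem deterministic (h : Runs p S S' m) (h' : Runs p S S'' n) : S' = S'' := by
  obtain ⟨_, _, h⟩ := h
  obtain ⟨_, _, h'⟩ := h'
  exact h.deterministic h'

theorem mono (h : Runs p S S' m) (hmn : m ≤ n) : Runs p S S' n :=
  let ⟨k, hk, h⟩ := h
  ⟨k, hk.trans hmn, h⟩

theorem congr (h : Runs p S S' m) (hS : S' = S'') (hmn : m ≤ n) : Runs p S S'' n :=
  hS ▸ h.mono hmn

theorem congr_start (h : Runs p S S' m) (hS : S'' = S) : Runs p S'' S' m := hS ▸ h

theorem skip : Runs .skip S S 1 := ⟨1, le_rfl, .skip⟩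

theorem push {k : K} {f : (K → Option A) → A} :
    Runs (.push k f) S (update S k (f (tops S) :: S k)) 1 := ⟨1, le_rfl, .push⟩

theorem pop {k : K} : Runs (.pop k) S (update S k (S k).tail) 1 := ⟨1, le_rfl, .pop⟩

theorem seq (h : Runs p S S' m) (h' : Runs q S' S'' n) : Runs (.seq p q) S S'' (m + n) :=
  let ⟨_, hk, h⟩ := h
  let ⟨_, hk', h'⟩ := h'
  ⟨_, add_le_add hk hk', .seq h h'⟩

theorem ite_true (hc : c (tops S) = true) (h : Runs p S S' n) :
    Runs (.ite c p q) S S' (n + 1) :=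
  let ⟨_, hk, h⟩ := h
  ⟨_, Nat.succ_le_succ hk, .ite_true hc h⟩

theorem ite_false (hc : c (tops S) = false) (h : Runs q S S' n) :
    Runs (.ite c p q) S S' (n + 1) :=
  let ⟨_, hk, h⟩ := h
  ⟨_, Nat.succ_le_succ hk, .ite_false hc h⟩

theorem loop_true (hc : c (tops S) = true) (h : Runs p S S' m) (h' : Runs (.loop c p) S' S'' n) :
    Runs (.loop c p) S S'' (m + n + 1) :=
  let ⟨_, hk, h⟩ := h
  let ⟨_, hk', h'⟩ := h'
  ⟨_, Nat.succ_le_succ (add_le_add hk hk'), .loop_true hc h h'⟩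

theorem loop_false (hc : c (tops S) = false) : Runs (.loop c p) S S 1 :=
  ⟨1, le_rfl, .loop_false hc⟩

end Runs

/-! ### Compilation to `TM2` machines -/

/-- The control points of a program. -/
def Label : StackProg K A → Type
  | .skip => Unit
  | .push _ _ => Unit
  | .pop _ => Unit
  | .seq p q => Label p ⊕ Label q
  | .ite _ p q => Option (Label p ⊕ Label q)
  | .loop _ p => Option (Label p)

omit [DecidableEq K] in
theorem finite_label : ∀ p : StackProg K A, Finite (Label p)
  | .skip => inferInstanceAs (Finite Unit)
  | .push _ _ => inferInstanceAs (Finite Unit)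
  | .pop _ => inferInstanceAs (Finite Unit)
  | .seq p q =>
    have := finite_label p
    have := finite_label q
    inferInstanceAs (Finite (Label p ⊕ Label q))
  | .ite _ p q =>
    have := finite_label p
    have := finite_label q
    inferInstanceAs (Finite (Option (Label p ⊕ Label q)))
  | .loop _ p =>
    have := finite_label p
    inferInstanceAs (Finite (Option (Label p)))

/-- The control point at which a program starts. -/
def entry : ∀ p : StackProg K A, Label p
  | .skip => ()
  | .push _ _ => ()
  | .pop _ => ()
  | .seq p _ => .inl (entry p)
  | .ite _ _ _ => none
  | .loop _ _ => none

variable {L : Type}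

/-- Load the tops of the stacks in a list into the internal state. -/
def peekAll (q : Turing.TM2.Stmt (fun _ : K => A) L (K → Option A)) :
    List K → Turing.TM2.Stmt (fun _ : K => A) L (K → Option A)
  | [] => q
  | k :: ks => .peek k (fun v a => update v k a) (peekAll q ks)

theorem stepAux_peekAll (q : Turing.TM2.Stmt (fun _ : K => A) L (K → Option A)) (ks : List K)
    (v : K → Option A) (S : K → List A) :
    Turing.TM2.stepAux (peekAll q ks) v S =
      Turing.TM2.stepAux q (fun k => if k ∈ ks then tops S k else v k) S := by
  induction ks generalizing v with
  | nil => simp [peekAll]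
  | cons k ks ih =>
    rw [peekAll, Turing.TM2.stepAux, ih]
    congr 1
    funext j
    by_cases hj : j ∈ ks
    · simp [hj]
    · by_cases hjk : j = k
      · subst hjk; simp [hj, tops]
      · simp [hj, hjk]

variable [Fintype K]

/-- Load the tops of all stacks into the internal state. -/
noncomputable def peekTops (q : Turing.TM2.Stmt (fun _ : K => A) L (K → Option A)) :
    Turing.TM2.Stmt (fun _ : K => A) L (K → Option A) :=
  peekAll q Finset.univ.toList

/-- Every coordinate of the internal state is overwritten, so tests and pushes depend on the stacks
alone and the old state `v` is irrelevant. -/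
theorem stepAux_peekTops (q : Turing.TM2.Stmt (fun _ : K => A) L (K → Option A))
    (v : K → Option A) (S : K → List A) :
    Turing.TM2.stepAux (peekTops q) v S = Turing.TM2.stepAux q (tops S) S := by
  simp [peekTops, stepAux_peekAll]

/-- The `TM2` statements of a program, embedded into a machine with labels `L` in which the
program is left at the label `exit`. -/
noncomputable def stmt : ∀ p : StackProg K A, (Label p → L) → L → Label p →
    Turing.TM2.Stmt (fun _ : K => A) L (K → Option A)
  | .skip, _, exit, _ => .goto fun _ => exit
  | .push k f, _, exit, _ => peekTops (.push k f (.goto fun _ => exit))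
  | .pop k, _, exit, _ => .pop k (fun v _ => v) (.goto fun _ => exit)
  | .seq p q, emb, exit, l =>
    Sum.elim (stmt p (fun i => emb (Sum.inl i)) (emb (Sum.inr (entry q))))
      (stmt q (fun i => emb (Sum.inr i)) exit) l
  | .ite c p q, emb, exit, l =>
    Option.elim l
      (peekTops (.branch c (.goto fun _ => emb (some (Sum.inl (entry p))))
        (.goto fun _ => emb (some (Sum.inr (entry q))))))
      (Sum.elim (stmt p (fun i => emb (some (Sum.inl i))) exit)
        (stmt q (fun i => emb (some (Sum.inr i))) exit))
  | .loop c p, emb, exit, l =>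
    Option.elim l
      (peekTops (.branch c (.goto fun _ => emb (some (entry p))) (.goto fun _ => exit)))
      (stmt p (fun i => emb (some i)) (emb none))

/-- The step count is exact: loading the tops and acting on them is one machine step, and sequencing
is free because the exit label of the first program is the entry of the second. Quantifying over
`emb`, `exit` and the ambient machine `M` lets the induction hypotheses apply to subprograms inside
a larger machine. -/
theorem Exec.simulation {p : StackProg K A} {S S' : K → List A} {n : ℕ} (h : Exec p S S' n) :
    ∀ {L : Type} (emb : Label p → L) (exit : L)
      (M : L → Turing.TM2.Stmt (fun _ : K => A) L (K → Option A)),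
      (∀ l, M (emb l) = stmt p emb exit l) → ∀ v : K → Option A, ∃ v' : K → Option A,
        (flip bind (Turing.TM2.step M))^[n] (some ⟨some (emb (entry p)), v, S⟩) =
          some ⟨some exit, v', S'⟩ := by
  induction h with
  | skip =>
    intro L emb exit M hM v
    exact ⟨v, by simp [flip, hM, stmt]⟩
  | push =>
    intro L emb exit M hM v
    exact ⟨_, by simp [flip, hM, stmt, stepAux_peekTops]; rfl⟩
  | pop =>
    intro L emb exit M hM v
    exact ⟨v, by simp [flip, hM, stmt]⟩
  | @seq p q _ _ _ _ _ _ _ ih₁ ih₂ =>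
    intro L emb exit M hM v
    obtain ⟨v₁, h₁⟩ := ih₁ (fun i => emb (Sum.inl i)) (emb (Sum.inr (entry q))) M
      (fun l => hM (Sum.inl l)) v
    obtain ⟨v₂, h₂⟩ := ih₂ (fun i => emb (Sum.inr i)) exit M (fun l => hM (Sum.inr l)) v₁
    refine ⟨v₂, ?_⟩
    rw [add_comm, iterate_add_apply]
    exact (congrArg _ h₁).trans h₂
  | @ite_true c p q S _ _ hc _ ih =>
    intro L emb exit M hM v
    obtain ⟨v₁, h₁⟩ := ih (fun i => emb (some (Sum.inl i))) exit M
      (fun l => hM (some (Sum.inl l))) (tops S)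
    refine ⟨v₁, ?_⟩
    rw [iterate_succ_apply, ← h₁]
    congr 1
    exact congrArg some ((congrArg (fun q => Turing.TM2.stepAux q v S) (hM none)).trans
      (by simp [stmt, stepAux_peekTops, hc]))
  | @ite_false c p q S _ _ hc _ ih =>
    intro L emb exit M hM v
    obtain ⟨v₁, h₁⟩ := ih (fun i => emb (some (Sum.inr i))) exit M
      (fun l => hM (some (Sum.inr l))) (tops S)
    refine ⟨v₁, ?_⟩
    rw [iterate_succ_apply, ← h₁]
    congr 1
    exact congrArg some ((congrArg (fun q => Turing.TM2.stepAux q v S) (hM none)).trans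
      (by simp [stmt, stepAux_peekTops, hc]))
  | @loop_true c p S _ _ _ _ hc _ _ ih₁ ih₂ =>
    intro L emb exit M hM v
    obtain ⟨v₁, h₁⟩ := ih₁ (fun i => emb (some i)) (emb none) M
      (fun l => hM (some l)) (tops S)
    -- The body exits to the test of the same loop, so the second hypothesis is about the whole loop
    -- again, with the same embedding.
    obtain ⟨v₂, h₂⟩ := ih₂ emb exit M hM v₁
    refine ⟨v₂, ?_⟩
    rw [iterate_succ_apply, add_comm, iterate_add_apply, ← h₂]
    congr 1
    refine Eq.trans ?_ h₁
    congr 1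
    exact congrArg some ((congrArg (fun q => Turing.TM2.stepAux q v S) (hM none)).trans
      (by simp [stmt, stepAux_peekTops, hc]))
  | @loop_false c p S hc =>
    intro L emb exit M hM v
    exact ⟨tops S, congrArg some ((congrArg (fun q => Turing.TM2.stepAux q v S) (hM none)).trans
      (by simp [stmt, stepAux_peekTops, hc]))⟩

variable [Fintype A]

/-- The machine of a program with input stack `k₀` and output stack `k₁`. -/
noncomputable def machine (p : StackProg K A) (k₀ k₁ : K) : Turing.FinTM2 :=
  { K := K
    k₀ := k₀
    k₁ := k₁
    Γ := fun _ => A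
    Λ := Option (Label p)
    main := some (entry p)
    ΛFin := have := finite_label p; Fintype.ofFinite (Option (Label p))
    σ := K → Option A
    initialState := fun _ => none
    m := fun l => Option.elim l (.load (fun _ _ => none) .halt) (stmt p some none) }

/-- The additional step is the label `none`, which resets the internal state before halting, as
`Turing.haltList` requires. All stacks other than the output must be empty as well, which is why the
main program ends by clearing. -/
theorem Runs.tm2Outputs {p : StackProg K A} {k₀ k₁ : K} {w v : List A} {n : ℕ}
    (h : Runs p (update (fun _ => []) k₀ w) (update (fun _ => []) k₁ v) n) :
    Nonempty (Turing.TM2OutputsInTime (machine p k₀ k₁) w (some v) (n + 1)) := by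
  obtain ⟨m, hm, h⟩ := h
  obtain ⟨v', hv'⟩ := h.simulation (some : Label p → Option (Label p)) none (machine p k₀ k₁).m
    (fun _ => rfl) (fun _ => none)
  have h₀ : Turing.initList (machine p k₀ k₁) w =
      ⟨some (some (entry p)), fun _ => none, update (fun _ => []) k₀ w⟩ := by
    refine (Turing.TM2.Cfg.mk.injEq ..).mpr ⟨rfl, rfl, ?_⟩
    change (fun k : K => _) = _
    funext k
    by_cases hk : k = k₀
    · cases hk
      exact (dif_pos rfl).trans (update_self (β := fun _ => List A) k₀ w _).symm
    · exact (dif_neg hk).trans (update_of_ne (β := fun _ => List A) hk w fun _ => []).symm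
  have h₁ : Turing.haltList (machine p k₀ k₁) v =
      ⟨none, fun _ => none, update (fun _ => []) k₁ v⟩ := by
    refine (Turing.TM2.Cfg.mk.injEq ..).mpr ⟨rfl, rfl, ?_⟩
    change (fun k : K => _) = _
    funext k
    by_cases hk : k = k₁
    · cases hk
      exact (dif_pos rfl).trans (update_self (β := fun _ => List A) k₁ v _).symm
    · exact (dif_neg hk).trans (update_of_ne (β := fun _ => List A) hk v fun _ => []).symm
  refine ⟨⟨⟨m + 1, ?_⟩, Nat.succ_le_succ hm⟩⟩
  have hw := (congrArg (flip bind (machine p k₀ k₁).step)^[m] (congrArg some h₀)).trans hv'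
  exact (iterate_succ_apply' ..).trans
    ((congrArg (flip bind (machine p k₀ k₁).step) hw).trans (congrArg some h₁.symm))

end StackProg

/-! ### Forward chaining and the disjunction property -/

/-- A sequent with its antecedent written as a list. -/
abbrev ListSequent : Type := List Formula × Formula

/-- The sequent written by a list sequent. -/
def ListSequent.toSequent (s : ListSequent) : Sequent := ⟨s.1.toFinset, s.2⟩

/-- The formula is in `Γ` or is the succedent of an activated sequent. -/
def Known (Γ : List Formula) (Y : List ListSequent) (a : Formula) : Prop :=
  a ∈ Γ ∨ ∃ y ∈ Y, y.2 = a

/-- All formulas in the antecedent are known. -/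
def Ready (Γ : List Formula) (Y : List ListSequent) (s : ListSequent) : Prop :=
  ∀ a ∈ s.1, Known Γ Y a

open Classical in
/-- Activate a sequent if its antecedent is known. -/
noncomputable def activate (Γ : List Formula) (Y : List ListSequent) (s : ListSequent) :
    List ListSequent :=
  if Ready Γ Y s then s :: Y else Y

/-- One pass of activations through a list of sequents. -/
noncomputable def pass (Γ : List Formula) (L Y : List ListSequent) : List ListSequent :=
  L.foldl (activate Γ) Y

/-- Every activated sequent has an antecedent known from the sequents activated before. -/
def Grounded (Γ : List Formula) : List ListSequent → Prop
  | [] => True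
  | s :: Y => Ready Γ Y s ∧ Grounded Γ Y

/-- No sequent of the list gives a new known formula. -/
def Saturated (Γ : List Formula) (L Y : List ListSequent) : Prop :=
  ∀ s ∈ L, Ready Γ Y s → ∃ y ∈ Y, y.2 = s.2

theorem subset_activate (Γ : List Formula) (Y : List ListSequent) (s : ListSequent) :
    Y ⊆ activate Γ Y s := by
  unfold activate
  split_ifs
  · exact List.subset_cons_self _ _
  · exact List.Subset.refl _

theorem subset_pass (Γ : List Formula) (L Y : List ListSequent) : Y ⊆ pass Γ L Y := by
  induction L generalizing Y with
  | nil => exact List.Subset.refl _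
  | cons s L ih => exact List.Subset.trans (subset_activate Γ Y s) (ih _)

theorem pass_subset (Γ : List Formula) (L Y : List ListSequent) : pass Γ L Y ⊆ L ++ Y := by
  induction L generalizing Y with
  | nil => exact List.Subset.refl _
  | cons s L ih =>
    intro x hx
    have := ih (activate Γ Y s) hx
    unfold activate at this
    split_ifs at this <;> simp at this ⊢ <;> tauto

theorem Grounded.pass {Γ : List Formula} {L Y : List ListSequent} (h : Grounded Γ Y) :
    Grounded Γ (pass Γ L Y) := by
  induction L generalizing Y with
  | nil => exact h
  | cons s L ih =>
    refine ih ?_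
    unfold activate
    split_ifs with hs
    · exact ⟨hs, h⟩
    · exact h

theorem Known.mono {Γ : List Formula} {Y Y' : List ListSequent} {a : Formula}
    (hY : ∀ y ∈ Y, ∃ y' ∈ Y', y'.2 = y.2) (h : Known Γ Y a) : Known Γ Y' a := by
  rcases h with h | ⟨y, hy, rfl⟩
  · exact Or.inl h
  · exact Or.inr (hY y hy)

/-- A pass only adds activated sequents, so a sequent that is ready at the outset is still ready
when its turn comes. -/
theorem exists_mem_pass {Γ : List Formula} {L Y : List ListSequent} {s : ListSequent}
    (hs : s ∈ L) (h : Ready Γ Y s) : ∃ y ∈ pass Γ L Y, y.2 = s.2 := by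
  induction L generalizing Y with
  | nil => simp at hs
  | cons t L ih =>
    have hsub := subset_activate Γ Y t
    rcases List.mem_cons.mp hs with rfl | hs
    · exact ⟨s, subset_pass Γ L _ (by simp [activate, h]), rfl⟩
    · exact ih hs fun a ha => (h a ha).mono fun y hy => ⟨y, hsub hy, rfl⟩

/-- A pass from a saturated list may activate sequents again, but by induction along the pass the
known formulas stay the same, so saturation keeps applying to each of them. -/
theorem Saturated.pass_succ {Γ : List Formula} {L Y : List ListSequent} (h : Saturated Γ L Y) :
    ∀ y ∈ pass Γ L Y, ∃ y' ∈ Y, y'.2 = y.2 := by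
  suffices H : ∀ (M Y' : List ListSequent), M ⊆ L → (∀ y ∈ Y', ∃ y' ∈ Y, y'.2 = y.2) →
      ∀ y ∈ NJp.pass Γ M Y', ∃ y' ∈ Y, y'.2 = y.2 from
    H L Y (List.Subset.refl _) fun y hy => ⟨y, hy, rfl⟩
  intro M
  induction M with
  | nil => intro Y' _ hY'; exact hY'
  | cons s M ih =>
    intro Y' hM hY'
    refine ih _ (List.subset_of_cons_subset hM) ?_
    unfold activate
    split_ifs with hs
    · intro y hy
      rcases List.mem_cons.mp hy with rfl | hy
      · exact h y (hM (by simp)) fun a ha => (hs a ha).mono hY'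
      · exact hY' y hy
    · exact hY'

theorem Saturated.pass {Γ : List Formula} {L Y : List ListSequent} (h : Saturated Γ L Y) :
    Saturated Γ L (pass Γ L Y) := by
  intro s hs hr
  obtain ⟨y, hy, hys⟩ := h s hs fun a ha => (hr a ha).mono h.pass_succ
  exact ⟨y, subset_pass Γ L Y hy, hys⟩

/-- The sequents activated after `n` passes. -/
noncomputable def passes (Γ : List Formula) (L : List ListSequent) (n : ℕ) : List ListSequent :=
  (pass Γ L)^[n] []

theorem passes_succ (Γ : List Formula) (L : List ListSequent) (n : ℕ) :
    passes Γ L (n + 1) = pass Γ L (passes Γ L n) :=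
  Function.iterate_succ_apply' ..

theorem passes_subset (Γ : List Formula) (L : List ListSequent) (n : ℕ) : passes Γ L n ⊆ L := by
  induction n with
  | zero => simp [passes]
  | succ n ih =>
    rw [passes_succ]
    exact List.Subset.trans (pass_subset Γ L _) (List.append_subset.mpr ⟨List.Subset.refl _, ih⟩)

theorem grounded_passes (Γ : List Formula) (L : List ListSequent) (n : ℕ) :
    Grounded Γ (passes Γ L n) := by
  induction n with
  | zero => trivial
  | succ n ih => rw [passes_succ]; exact ih.pass

/-- As long as saturation fails, each pass adds at least one succedent not present before, so the
number of distinct succedents keeps up with the number of passes. -/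
theorem saturated_passes_or_le (Γ : List Formula) (L : List ListSequent) (n : ℕ) :
    Saturated Γ L (passes Γ L n) ∨ n ≤ ((passes Γ L n).map Prod.snd).toFinset.card := by
  induction n with
  | zero => exact Or.inr (Nat.zero_le _)
  | succ n ih =>
    rw [passes_succ]
    rcases ih with ih | ih
    · exact Or.inl ih.pass
    by_cases h : Saturated Γ L (passes Γ L n)
    · exact Or.inl h.pass
    refine Or.inr (Nat.succ_le_of_lt (ih.trans_lt (Finset.card_lt_card ?_)))
    unfold Saturated at h
    push Not at h
    obtain ⟨s, hs, hr, hn⟩ := h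
    rw [Finset.ssubset_iff_of_subset]
    · obtain ⟨y, hy, hys⟩ := exists_mem_pass hs hr
      refine ⟨s.2, ?_, ?_⟩
      · simp only [List.mem_toFinset, List.mem_map]
        exact ⟨y, hy, hys⟩
      · simp only [List.mem_toFinset, List.mem_map, not_exists, not_and]
        exact hn
    · intro a
      simp only [List.mem_toFinset, List.mem_map]
      rintro ⟨y, hy, rfl⟩
      exact ⟨y, subset_pass Γ L _ hy, rfl⟩

theorem saturated_passes {Γ : List Formula} {L : List ListSequent} {n : ℕ} (hn : L.length < n) :
    Saturated Γ L (passes Γ L n) := by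
  refine (saturated_passes_or_le Γ L n).resolve_right fun h => ?_
  have h₁ : ((passes Γ L n).map Prod.snd).toFinset ⊆ (L.map Prod.snd).toFinset := by
    intro a
    simp only [List.mem_toFinset, List.mem_map]
    rintro ⟨y, hy, rfl⟩
    exact ⟨y, passes_subset Γ L n hy, rfl⟩
  have h₂ := Finset.card_le_card h₁
  have h₃ := List.toFinset_card_le (L.map Prod.snd)
  rw [List.length_map] at h₃
  omega

/-! ### The slash relation and its soundness. -/

/-- A variant of the Aczel slash relative to a set of formulas. -/
def Slash (T : Set Formula) : Formula → Prop
  | .atom _ => True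
  | .bot => True
  | .or α β => (α ∈ T ∧ Slash T α) ∨ (β ∈ T ∧ Slash T β)
  | .and α β => Slash T α ∧ Slash T β
  | .imp α β => α ∈ T ∧ Slash T α → Slash T β

/-- Only the clause for disjunctions asks for evidence in `T`, and the strictly positive positions
are the only ones visited: for an implication the consequent alone has to be slashed. -/
theorem Formula.IsHarrop.slash {α : Formula} (h : α.IsHarrop) (T : Set Formula) : Slash T α := by
  induction α with
  | atom n => trivial
  | bot => trivial
  | or α β => exact absurd .refl (h α β)
  | and α β ih₀ ih₁ =>
    exact ⟨ih₀ fun γ δ hs => h γ δ (.and_left hs), ih₁ fun γ δ hs => h γ δ (.and_right hs)⟩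
  | imp α β _ ih => exact fun _ => ih fun γ δ hs => h γ δ (.imp_right hs)

theorem Derivation.self_mem_sequents {s : Sequent} (d : Derivation s) : s ∈ d.sequents := by
  cases d <;> simp [Derivation.sequents]

/-- Soundness of the slash, for a set closed under the sequents of the derivation. -/
theorem Derivation.slash {Γ : Cedent} {T : Set Formula} {s : Sequent} (d : Derivation s)
    (hT : ∀ q ∈ d.sequents, (∀ a ∈ q.ante, a ∈ Γ ∨ a ∈ T) → q.succ ∈ T)
    (hs : ∀ a ∈ s.ante, (a ∈ Γ ∨ a ∈ T) ∧ Slash T a) : s.succ ∈ T ∧ Slash T s.succ := by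
  refine ⟨hT s d.self_mem_sequents fun a ha => (hs a ha).1, ?_⟩
  induction d with
  | ax h => exact (hs _ h).2
  -- Ex falso is available for atoms only, and atoms are slashed by definition.
  | botAx h => trivial
  | orE d d₀ d₁ ih ih₀ ih₁ =>
    have hd := ih (fun q hq => hT q (by simp [sequents, hq])) hs
    -- The slash of the major premise selects a disjunct that is in `T` and slashed, exactly what
    -- the enlarged antecedent of the corresponding minor premise demands.
    rcases hd with hd | hd
    · refine ih₀ (fun q hq => hT q (by simp [sequents, hq])) fun a ha => ?_
      rcases Finset.mem_insert.mp ha with rfl | ha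
      · exact ⟨Or.inr hd.1, hd.2⟩
      · exact hs a ha
    · refine ih₁ (fun q hq => hT q (by simp [sequents, hq])) fun a ha => ?_
      rcases Finset.mem_insert.mp ha with rfl | ha
      · exact ⟨Or.inr hd.1, hd.2⟩
      · exact hs a ha
  | orI₀ d ih =>
    have hd := fun q (hq : q ∈ d.sequents) => hT q (by simp [sequents, hq])
    exact Or.inl ⟨hd _ d.self_mem_sequents fun a ha => (hs a ha).1, ih hd hs⟩
  | orI₁ d ih =>
    have hd := fun q (hq : q ∈ d.sequents) => hT q (by simp [sequents, hq])
    exact Or.inr ⟨hd _ d.self_mem_sequents fun a ha => (hs a ha).1, ih hd hs⟩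
  | andE₀ d ih => exact (ih (fun q hq => hT q (by simp [sequents, hq])) hs).1
  | andE₁ d ih => exact (ih (fun q hq => hT q (by simp [sequents, hq])) hs).2
  | andI d₀ d₁ ih₀ ih₁ =>
    exact ⟨ih₀ (fun q hq => hT q (by simp [sequents, hq])) hs,
      ih₁ (fun q hq => hT q (by simp [sequents, hq])) hs⟩
  | impE d₀ d₁ ih₀ ih₁ =>
    have hd := fun q (hq : q ∈ d₁.sequents) => hT q (by simp [sequents, hq])
    exact ih₀ (fun q hq => hT q (by simp [sequents, hq])) hs
      ⟨hd _ d₁.self_mem_sequents fun a ha => (hs a ha).1, ih₁ hd hs⟩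
  | impI d ih =>
    intro h
    refine ih (fun q hq => hT q (by simp [sequents, hq])) fun a ha => ?_
    rcases Finset.mem_insert.mp ha with rfl | ha
    · exact ⟨Or.inr h.1, h.2⟩
    · exact hs a ha

/-- After saturation a disjunct of the end formula is the succedent of an activated sequent. -/
theorem Derivation.exists_disjunct {Γ : Cedent} {α β : Formula} (d : Derivation ⟨Γ, .or α β⟩)
    (hΓ : Γ.IsHarrop) {G : List Formula} {L Y : List ListSequent} (hG : ∀ a, a ∈ G ↔ a ∈ Γ)
    (hL : ∀ q ∈ d.sequents, ∃ s ∈ L, s.toSequent = q) (hY : Saturated G L Y) :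
    ∃ y ∈ Y, y.2 = α ∨ y.2 = β := by
  -- Take for `T` the succedents of the activated sequents; saturation is the closure hypothesis of
  -- the slash lemma.
  have h := d.slash (Γ := Γ) (T := {a | ∃ y ∈ Y, y.2 = a}) (by
    intro q hq h
    obtain ⟨s, hs, rfl⟩ := hL q hq
    refine hY s hs fun a ha => ?_
    exact (h a (List.mem_toFinset.mpr ha)).imp_left (hG a).mpr)
    fun a ha => ⟨Or.inl ha, (hΓ a ha).slash _⟩
  rcases h.2 with ⟨⟨y, hy, h⟩, _⟩ | ⟨⟨y, hy, h⟩, _⟩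
  · exact ⟨y, hy, Or.inl h⟩
  · exact ⟨y, hy, Or.inr h⟩

/-! ### Backward reading of the activated sequents -/

/-- The string of a list of formulas, each closed by a comma. -/
def itemsCode (l : List Formula) : List Symbol :=
  l.flatMap fun α => α.code ++ [.comma]

/-- The string of a list sequent. -/
def ListSequent.code (s : ListSequent) : List Symbol :=
  itemsCode s.1 ++ [.arrow] ++ s.2.code

theorem ListSequent.isCode (s : ListSequent) : s.toSequent.IsCode s.code :=
  ⟨s.1, rfl, rfl⟩

/-- Cut the activated sequents, in order, into a deduction with string `out` of the sequent
`cur ⇒ γ`. -/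
def cutAll (γ : Formula) : List ListSequent → List Formula → List Symbol → List Symbol
  | [], _, out => out
  | s :: Y, cur, out =>
    if s.2 ∈ cur then
      cutAll γ Y (s.1 ++ cur.filter (· ≠ s.2))
        (.ruleCut :: (ListSequent.code (s.1 ++ cur.filter (· ≠ s.2), γ) ++
          .ruleInit :: s.code ++ out))
    else cutAll γ Y cur out

/-- Look for the first activated sequent that proves a disjunct, and complete it to a
deduction. -/
def extract (α β : Formula) : List ListSequent → List Symbol
  | [] => []
  | s :: Y =>
    if s.2 = α then .zero :: cutAll α Y s.1 (.ruleInit :: s.code)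
    else if s.2 = β then .one :: cutAll β Y s.1 (.ruleInit :: s.code)
    else extract α β Y

/-- The invariant is that `out` writes a deduction of `cur ⇒ γ` and that every formula of `cur` is
known from the sequents still to come. After `s` has been dealt with, its succedent can remain or
return only if it is known from `Γ` or from sequents further back. When the list is exhausted, known
means being in `Γ`. -/
theorem cutAll_correct {S : Finset Sequent} {Γ : List Formula} {γ : Formula}
    {Y : List ListSequent} (hS : ∀ y ∈ Y, y.toSequent ∈ S) (hY : Grounded Γ Y)
    {cur : List Formula} {out : List Symbol} (hcur : ∀ a ∈ cur, Known Γ Y a)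
    (hout : ∃ c : CutDeduction S (ListSequent.toSequent (cur, γ)), c.IsCode out) :
    ∃ (l : List Formula) (c : CutDeduction S (ListSequent.toSequent (l, γ))), l ⊆ Γ ∧
      c.IsCode (cutAll γ Y cur out) := by
  induction Y generalizing cur out with
  | nil =>
    obtain ⟨c, hc⟩ := hout
    refine ⟨cur, c, fun a ha => ?_, hc⟩
    simpa [Known] using hcur a ha
  | cons s Y ih =>
    have hS' : ∀ y ∈ Y, y.toSequent ∈ S := fun y hy => hS y (List.mem_cons_of_mem _ hy)
    unfold cutAll
    split_ifs with hs
    · refine ih hS' hY.2 (fun a ha => ?_) ?_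
      · rcases List.mem_append.mp ha with ha | ha
        · exact hY.1 a ha
        · obtain ⟨ha, hne⟩ := List.mem_filter.mp ha
          rcases hcur a ha with h | ⟨y, hy, h⟩
          · exact Or.inl h
          · rcases List.mem_cons.mp hy with rfl | hy
            · simp [h] at hne
            · exact Or.inr ⟨y, hy, h⟩
      -- Cedents are sets, so `cur` can be presented as the cut formula inserted into the filtered
      -- list, the form the cut rule requires.
      · have h₀ : ListSequent.toSequent (cur, γ) =
            ⟨insert s.2 (cur.filter (· ≠ s.2)).toFinset, γ⟩ := by
          simp only [ListSequent.toSequent, Sequent.mk.injEq, and_true]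
          ext a
          simp only [List.mem_toFinset, Finset.mem_insert, List.mem_filter, decide_eq_true_eq]
          by_cases ha : a = s.2
          · subst ha; simp [hs]
          · simp [ha]
        have h₁ : ListSequent.toSequent (s.1 ++ cur.filter (· ≠ s.2), γ) =
            ⟨s.1.toFinset ∪ (cur.filter (· ≠ s.2)).toFinset, γ⟩ := by
          simp [ListSequent.toSequent]
        have h₂ := ListSequent.isCode (s.1 ++ cur.filter (· ≠ s.2), γ)
        rw [h₁] at h₂ ⊢
        rw [h₀] at hout
        obtain ⟨c, hc⟩ := hout
        refine ⟨.cut (.init (hS s (by simp))) c, ?_⟩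
        simp only [CutDeduction.IsCode]
        exact ⟨_, _, _, h₂, ⟨s.code, s.isCode, rfl⟩, hc, by simp⟩
    · refine ih hS' hY.2 (fun a ha => ?_) hout
      rcases hcur a ha with h | ⟨y, hy, h⟩
      · exact Or.inl h
      · rcases List.mem_cons.mp hy with rfl | hy
        · exact absurd (h ▸ ha) hs
        · exact Or.inr ⟨y, hy, h⟩

/-- Sequents skipped in the search are in front of the chosen one, hence were activated later, and
its antecedent does not depend on them. -/
theorem extract_correct {S : Finset Sequent} {Γ : List Formula} {α : Fin 2 → Formula}
    {Y : List ListSequent} (hS : ∀ y ∈ Y, y.toSequent ∈ S) (hY : Grounded Γ Y)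
    (h : ∃ y ∈ Y, y.2 = α 0 ∨ y.2 = α 1) :
    ∃ (i : Fin 2) (l : List Formula) (c : CutDeduction S (ListSequent.toSequent (l, α i)))
      (v : List Symbol), l ⊆ Γ ∧ c.IsCode v ∧
        extract (α 0) (α 1) Y = Symbol.ofBool (decide (i = 1)) :: v := by
  induction Y with
  | nil => simp at h
  | cons s Y ih =>
    have hS' : ∀ y ∈ Y, y.toSequent ∈ S := fun y hy => hS y (List.mem_cons_of_mem _ hy)
    have key : ∀ i, s.2 = α i → ∃ (l : List Formula)
        (c : CutDeduction S (ListSequent.toSequent (l, α i))), l ⊆ Γ ∧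
          c.IsCode (cutAll (α i) Y s.1 (.ruleInit :: s.code)) := by
      intro i hi
      refine cutAll_correct hS' hY.2 hY.1 ?_
      have hs : ListSequent.toSequent (s.1, α i) = s.toSequent := by rw [← hi]
      rw [hs]
      refine ⟨.init (hS s (by simp)), ?_⟩
      simp only [CutDeduction.IsCode]
      exact ⟨_, s.isCode, rfl⟩
    unfold extract
    split_ifs with h₀ h₁
    · obtain ⟨l, c, hl, hc⟩ := key 0 h₀
      exact ⟨0, l, c, _, hl, hc, rfl⟩
    · obtain ⟨l, c, hl, hc⟩ := key 1 h₁
      exact ⟨1, l, c, _, hl, hc, rfl⟩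
    · refine ih hS' hY.2 ?_
      obtain ⟨y, hy, h⟩ := h
      rcases List.mem_cons.mp hy with rfl | hy
      · tauto
      · exact ⟨y, hy, h⟩

/-! ### Reading the strings -/

instance : Fintype Symbol :=
  ⟨{.zero, .one, .atom, .bot, .or, .and, .imp, .comma, .arrow, .ruleAx, .ruleBotAx, .ruleOrE,
    .ruleOrI₀, .ruleOrI₁, .ruleAndE₀, .ruleAndE₁, .ruleAndI, .ruleImpE, .ruleImpI, .ruleInit,
    .ruleCut}, fun x => by cases x <;> decide⟩

/-- The symbols that occur in formulas. -/
def Symbol.isFormula : Symbol → Bool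
  | .zero | .one | .atom | .bot | .or | .and | .imp => true
  | _ => false

/-- The names of axioms and inference rules. -/
def Symbol.isRule : Symbol → Bool
  | .zero | .one | .atom | .bot | .or | .and | .imp | .comma | .arrow => false
  | _ => true

/-- The string does not continue a formula. -/
def Ends (w : List Symbol) : Prop := ∀ a ∈ w.head?, a.isFormula = false

@[simp] theorem ends_nil : Ends [] := by simp [Ends]

@[simp] theorem ends_cons (a : Symbol) (w : List Symbol) :
    Ends (a :: w) ↔ a.isFormula = false := by simp [Ends]

theorem Symbol.isFormula_eq_false_of_isRule {a : Symbol} (h : a.isRule) :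
    a.isFormula = false := by
  cases a <;> simp_all [isRule, isFormula]

theorem Symbol.isFormula_ofBool (b : Bool) : (Symbol.ofBool b).isFormula = true := by
  cases b <;> rfl

theorem Formula.isFormula_of_mem_code {α : Formula} {a : Symbol} (h : a ∈ α.code) :
    a.isFormula = true := by
  induction α with
  | atom n =>
    simp only [code, List.mem_append, List.mem_map, List.mem_singleton] at h
    rcases h with ⟨b, _, rfl⟩ | rfl
    · exact Symbol.isFormula_ofBool b
    · rfl
  | bot => simp only [code, List.mem_singleton] at h; subst h; rfl
  | or α β ih₀ ih₁ | and α β ih₀ ih₁ | imp α β ih₀ ih₁ =>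
    simp only [code, List.mem_cons, List.mem_append] at h
    rcases h with rfl | h | h
    · rfl
    · exact ih₀ h
    · exact ih₁ h

theorem nat_bits_injective : Function.Injective Nat.bits := fun m n h =>
  Nat.eq_of_testBit_eq fun i => by rw [Nat.testBit_eq_inth, Nat.testBit_eq_inth, h]

theorem ofBool_append_inj {l l' : List Bool} {x y : List Symbol}
    (h : l.map Symbol.ofBool ++ .atom :: x = l'.map Symbol.ofBool ++ .atom :: y) :
    l = l' ∧ x = y := by
  induction l generalizing l' with
  | nil =>
    cases l' with
    | nil => simpa using h
    | cons b l' => cases b <;> simp [Symbol.ofBool] at h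
  | cons b l ih =>
    cases l' with
    | nil => cases b <;> simp [Symbol.ofBool] at h
    | cons b' l' =>
      simp only [List.map_cons, List.cons_append, List.cons.injEq] at h
      obtain ⟨rfl, rfl⟩ := ih h.2
      have : b = b' := by cases b <;> cases b' <;> simp_all [Symbol.ofBool]
      simp [this]

/-- Polish notation is prefix-free: the leading symbol fixes the connective, and an atom is
delimited by its closing symbol. -/
theorem Formula.code_append_inj {α β : Formula} {x y : List Symbol}
    (h : α.code ++ x = β.code ++ y) : α = β ∧ x = y := by
  -- The string of an atom begins with a digit or, if the expansion is empty, with the symbol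
  -- `atom`; this separates atoms from all other formulas.
  have hb : ∀ (n : ℕ) (z w : List Symbol) (a : Symbol), a ≠ .zero → a ≠ .one → a ≠ .atom →
      n.bits.map Symbol.ofBool ++ .atom :: z ≠ a :: w := by
    intro n z w a h₀ h₁ h₂ h
    cases hn : n.bits with
    | nil => simp_all
    | cons b l => cases b <;> simp_all [Symbol.ofBool]
  induction α generalizing β x y with
  | atom n =>
    cases β with
    | atom m =>
      simp only [code, List.append_assoc, List.singleton_append] at h
      obtain ⟨hn, rfl⟩ := ofBool_append_inj h
      simp [nat_bits_injective hn]
    | _ =>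
      simp only [code, List.append_assoc, List.cons_append] at h
      exact absurd h (hb _ _ _ _ (by decide) (by decide) (by decide))
  | bot =>
    cases β with
    | bot => simpa [code] using h
    | atom m =>
      simp only [code, List.append_assoc, List.singleton_append] at h
      exact absurd h.symm (hb _ _ _ _ (by decide) (by decide) (by decide))
    | _ => simp [code] at h
  | or α₀ α₁ ih₀ ih₁ | and α₀ α₁ ih₀ ih₁ | imp α₀ α₁ ih₀ ih₁ =>
    cases β with
    | atom m =>
      simp only [code, List.append_assoc, List.cons_append] at h
      exact absurd h.symm (hb _ _ _ _ (by decide) (by decide) (by decide))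
    | or β₀ β₁ | and β₀ β₁ | imp β₀ β₁ =>
      simp only [code, List.cons_append, List.append_assoc, List.cons.injEq, true_and,
        reduceCtorEq, false_and] at h <;>
      · obtain ⟨rfl, h'⟩ := ih₀ h
        obtain ⟨rfl, rfl⟩ := ih₁ h'
        exact ⟨rfl, rfl⟩
    | bot => simp [code] at h

theorem Formula.code_injective : Function.Injective Formula.code := fun α β h =>
  (code_append_inj (x := []) (y := []) (by simpa using h)).1

/-- A list sequent introduced by the name of a rule. -/
def ruleCode (e : Symbol × ListSequent) : List Symbol := e.1 :: e.2.code

/-- The string of a derivation is a list of its sequents, each introduced by a rule name, the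
first one being the end sequent. -/
theorem Derivation.IsCode.exists_list {s : Sequent} {d : Derivation s} {w : List Symbol}
    (h : d.IsCode w) :
    ∃ (e : Symbol × ListSequent) (M : List (Symbol × ListSequent)),
      e.2.toSequent = s ∧ (∀ x ∈ e :: M, x.1.isRule = true) ∧ w = (e :: M).flatMap ruleCode ∧
        ∀ q, q ∈ d.sequents ↔ ∃ x ∈ e :: M, x.2.toSequent = q := by
  have hu : ∀ {s : Sequent} {u : List Symbol}, s.IsCode u →
      ∃ t : ListSequent, t.toSequent = s ∧ u = t.code := by
    rintro ⟨Γ, α⟩ u ⟨l, hl, rfl⟩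
    exact ⟨(l, α), by simpa [ListSequent.toSequent] using hl, rfl⟩
  -- Common to all rules: given the concatenated lists `M` of the immediate subderivations, put the
  -- end sequent in front.
  have key : ∀ {s : Sequent} {d : Derivation s} {r : Symbol} {w : List Symbol} (t : ListSequent)
      (M : List (Symbol × ListSequent)), r.isRule = true → t.toSequent = s →
      (∀ x ∈ M, x.1.isRule = true) → w = t.code ++ M.flatMap ruleCode →
      (∀ q, q ∈ d.sequents ↔ q = s ∨ ∃ x ∈ M, x.2.toSequent = q) →
      ∃ (e : Symbol × ListSequent) (M : List (Symbol × ListSequent)),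
        e.2.toSequent = s ∧ (∀ x ∈ e :: M, x.1.isRule = true) ∧
          r :: w = (e :: M).flatMap ruleCode ∧
          ∀ q, q ∈ d.sequents ↔ ∃ x ∈ e :: M, x.2.toSequent = q := by
    intro s d r w t M hr ht hM hw hq
    refine ⟨(r, t), M, ht, ?_, by simp [hw, ruleCode], fun q => ?_⟩
    · intro x hx
      rcases List.mem_cons.mp hx with rfl | hx
      exacts [hr, hM x hx]
    · simp only [hq, List.exists_mem_cons_iff, ht, eq_comm (a := q)]
  induction d generalizing w with
  | ax _ | botAx _ =>
    obtain ⟨u, hs, rfl⟩ := h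
    obtain ⟨t, ht, rfl⟩ := hu hs
    exact key t [] rfl ht (by simp) (by simp) fun q => by simp [sequents]
  | orE d d₀ d₁ ih ih₀ ih₁ =>
    obtain ⟨u, v, v₀, v₁, hs, hv, hv₀, hv₁, rfl⟩ := h
    obtain ⟨t, ht, rfl⟩ := hu hs
    obtain ⟨e, M, -, hr, rfl, hq⟩ := ih hv
    obtain ⟨e₀, M₀, -, hr₀, rfl, hq₀⟩ := ih₀ hv₀
    obtain ⟨e₁, M₁, -, hr₁, rfl, hq₁⟩ := ih₁ hv₁
    refine key t ((e :: M) ++ (e₀ :: M₀) ++ (e₁ :: M₁)) rfl ht ?_ ?_ fun q => ?_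
    · intro x hx
      simp only [List.mem_append] at hx
      rcases hx with (hx | hx) | hx
      exacts [hr x hx, hr₀ x hx, hr₁ x hx]
    · simp only [List.flatMap_append, List.append_assoc]
    · simp only [sequents, Finset.mem_insert, Finset.mem_union, hq, hq₀, hq₁,
        List.mem_append, or_and_right, exists_or]
  | orI₀ d ih | orI₁ d ih | andE₀ d ih | andE₁ d ih | impI d ih =>
    obtain ⟨u, v, hs, hv, rfl⟩ := h
    obtain ⟨t, ht, rfl⟩ := hu hs
    obtain ⟨e, M, -, hr, rfl, hq⟩ := ih hv
    exact key t (e :: M) rfl ht hr rfl fun q => by simp only [sequents, Finset.mem_insert, hq]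
  | andI d₀ d₁ ih₀ ih₁ | impE d₀ d₁ ih₀ ih₁ =>
    obtain ⟨u, v₀, v₁, hs, hv₀, hv₁, rfl⟩ := h
    obtain ⟨t, ht, rfl⟩ := hu hs
    obtain ⟨e₀, M₀, -, hr₀, rfl, hq₀⟩ := ih₀ hv₀
    obtain ⟨e₁, M₁, -, hr₁, rfl, hq₁⟩ := ih₁ hv₁
    refine key t ((e₀ :: M₀) ++ (e₁ :: M₁)) rfl ht ?_ ?_ fun q => ?_
    · intro x hx
      rcases List.mem_append.mp hx with hx | hx
      exacts [hr₀ x hx, hr₁ x hx]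
    · simp only [List.flatMap_append, List.append_assoc]
    · simp only [sequents, Finset.mem_insert, Finset.mem_union, hq₀, hq₁,
        List.mem_append, or_and_right, exists_or]

infixr:60 " ;; " => StackProg.seq

namespace StackProg

/-! ### Subroutines -/

section

variable {K : Type}

/-- Move the top of `a` to `b`. -/
def move (a b : K) : StackProg K Symbol :=
  .push b (fun τ => (τ a).getD .zero) ;; .pop a

/-- Push a fixed symbol. -/
def put (a : K) (x : Symbol) : StackProg K Symbol := .push a fun _ => x

/-- Move symbols from `a` to `b` as long as they satisfy a test. -/
def moveWhile (p : Symbol → Bool) (a b : K) : StackProg K Symbol :=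
  .loop (fun τ => (τ a).any p) (move a b)

/-- Drop symbols from `a` as long as they satisfy a test. -/
def dropWhile (p : Symbol → Bool) (a : K) : StackProg K Symbol :=
  .loop (fun τ => (τ a).any p) (.pop a)

/-- Empty a stack. -/
def clear (a : K) : StackProg K Symbol := dropWhile (fun _ => true) a

/-- Move the content of `a`, in reversed order, to `b`. -/
def moveAll (a b : K) : StackProg K Symbol := moveWhile (fun _ => true) a b

/-- Move symbols satisfying a test from `a` to `b`, in the same order, by means of `t`. -/
def take (p : Symbol → Bool) (a b t : K) : StackProg K Symbol :=
  moveWhile p a t ;; moveAll t b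

/-- Copy the content of `a` to the top of `b` by means of `t`. -/
def copy (a b t : K) : StackProg K Symbol :=
  moveAll a t ;;
    .loop (fun τ => (τ t).any fun _ => true)
      (.push b (fun τ => (τ t).getD .zero) ;; move t a)

variable [DecidableEq K] {S : K → List Symbol} {a b t : K} {p : Symbol → Bool}
  {x z : List Symbol}

theorem runs_put {c : Symbol} : Runs (put a c) S (update S a (c :: S a)) 1 := Runs.push

theorem runs_pop {c : Symbol} {l : List Symbol} (h : S a = c :: l) :
    Runs (.pop a) S (update S a l) 1 :=
  Runs.pop.congr (by rw [h]; rfl) le_rfl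

theorem runs_move (hab : a ≠ b) {c : Symbol} {l : List Symbol} (h : S a = c :: l) :
    Runs (move a b) S (update (update S a l) b (c :: S b)) 2 := by
  refine (Runs.push.seq Runs.pop).congr ?_ le_rfl
  funext k
  simp only [update_apply, tops]
  split_ifs <;> simp_all

theorem runs_moveWhile (hab : a ≠ b) (h : S a = x ++ z) (hx : ∀ c ∈ x, p c = true)
    (hz : ∀ c ∈ z.head?, p c = false) :
    Runs (moveWhile p a b) S (update (update S a z) b (x.reverse ++ S b)) (3 * x.length + 1) := by
  induction x generalizing S with
  | nil =>
    refine (Runs.loop_false ?_).congr ?_ (by simp)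
    · cases z with
      | nil => simp [tops, h]
      | cons c z => simpa [tops, h] using hz
    · funext k
      simp only [update_apply]
      split_ifs <;> simp_all
  | cons c x ih =>
    have hm := runs_move hab (c := c) (l := x ++ z) h
    refine (Runs.loop_true (by simp [tops, h, hx]) hm
      (ih (S := update (update S a (x ++ z)) b (c :: S b)) (by simp [hab])
        fun d hd => hx d (List.mem_cons_of_mem _ hd))).congr ?_
      (by simp only [List.length_cons]; omega)
    funext k
    simp only [update_apply]
    split_ifs <;> simp_all

theorem runs_dropWhile (h : S a = x ++ z) (hx : ∀ c ∈ x, p c = true)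
    (hz : ∀ c ∈ z.head?, p c = false) :
    Runs (dropWhile p a) S (update S a z) (2 * x.length + 1) := by
  induction x generalizing S with
  | nil =>
    refine (Runs.loop_false ?_).congr ?_ (by simp)
    · cases z with
      | nil => simp [tops, h]
      | cons c z => simpa [tops, h] using hz
    · funext k
      simp only [update_apply]
      split_ifs <;> simp_all
  | cons c x ih =>
    refine (Runs.loop_true (by simp [tops, h, hx]) (runs_pop (l := x ++ z) h)
      (ih (S := update S a (x ++ z)) (by simp)
        fun d hd => hx d (List.mem_cons_of_mem _ hd))).congr (by simp)
      (by simp only [List.length_cons]; omega)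

theorem runs_clear : Runs (clear a) S (update S a []) (2 * (S a).length + 1) :=
  runs_dropWhile (x := S a) (by simp) (by simp) (by simp)

theorem runs_moveAll (hab : a ≠ b) :
    Runs (moveAll a b) S (update (update S a []) b ((S a).reverse ++ S b))
      (3 * (S a).length + 1) :=
  runs_moveWhile hab (by simp) (by simp) (by simp)

theorem runs_take (hat : a ≠ t) (hbt : b ≠ t) (hab : a ≠ b) (ht : S t = [])
    (h : S a = x ++ z) (hx : ∀ c ∈ x, p c = true) (hz : ∀ c ∈ z.head?, p c = false) :
    Runs (take p a b t) S (update (update S a z) b (x ++ S b)) (6 * x.length + 2) := by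
  refine ((runs_moveWhile hat h hx hz).seq (runs_moveAll hbt.symm)).congr ?_ ?_
  · funext k
    simp only [update_apply]
    split_ifs <;> simp_all
  · simp [ht]; omega

theorem runs_copy (hat : a ≠ t) (hbt : b ≠ t) (hab : a ≠ b) (ht : S t = []) :
    Runs (copy a b t) S (update S b (S a ++ S b)) (7 * (S a).length + 2) := by
  -- The first loop leaves the content reversed on `t`; this second loop reverses it once more, onto
  -- `b` and back onto `a` at the same time.
  have key : ∀ (l : List Symbol) (S : K → List Symbol), S t = l →
      Runs (.loop (fun τ => (τ t).any fun _ => true)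
        (.push b (fun τ => (τ t).getD .zero) ;; move t a)) S
        (update (update (update S t []) a (l.reverse ++ S a)) b (l.reverse ++ S b))
        (4 * l.length + 1) := by
    intro l
    induction l with
    | nil =>
      intro S h
      refine (Runs.loop_false (by simp [tops, h])).congr ?_ (by simp)
      funext k
      simp only [update_apply]
      split_ifs <;> simp_all
    | cons c l ih =>
      intro S h
      refine (Runs.loop_true (by simp [tops, h]) (Runs.push.seq
        (runs_move hat.symm (c := c) (l := l) (by simp [hbt.symm, h]))) (ih _ ?_)).congr ?_ ?_
      · simp [hat.symm]
      · funext k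
        simp only [update_apply, tops]
        split_ifs <;> simp_all
      · simp only [List.length_cons]; omega
  refine ((runs_moveAll hat).seq (key _ _ rfl)).congr ?_ ?_
  · funext k
    simp only [update_apply]
    split_ifs <;> simp_all
  · simp [ht]; omega

end

end StackProg

/-! ### Occurrences of formulas in strings -/

/-- The string `y` starts with the formula string `x`. -/
def IsItem (x y : List Symbol) : Prop := ∃ z, y = x ++ z ∧ Ends z

/-- Somewhere in the string, the arrow is followed by the formula string `x`. -/
def Occurs (x : List Symbol) : List Symbol → Prop
  | [] => False
  | a :: y => (a = .arrow ∧ IsItem x y) ∨ Occurs x y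

/-- Each of `x` and `y` is the longest initial block of formula symbols of the common string. A
whole formula can thus be recognized by its following symbol, without parsing. -/
theorem append_inj_of_ends {x y z w : List Symbol} (hx : ∀ a ∈ x, a.isFormula = true)
    (hy : ∀ a ∈ y, a.isFormula = true) (hz : Ends z) (hw : Ends w) (h : x ++ z = y ++ w) :
    x = y := by
  induction x generalizing y with
  | nil =>
    cases y with
    | nil => rfl
    | cons b y =>
      simp only [List.nil_append, List.cons_append] at h
      subst h
      simp_all
  | cons a x ih =>
    cases y with
    | nil =>
      simp only [List.nil_append, List.cons_append] at h
      subst h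
      simp_all
    | cons b y =>
      simp only [List.cons_append, List.cons.injEq] at h
      rw [h.1, ih (fun c hc => hx c (List.mem_cons_of_mem _ hc))
        (fun c hc => hy c (List.mem_cons_of_mem _ hc)) h.2]

theorem isItem_code {α β : Formula} {z : List Symbol} (hz : Ends z) :
    IsItem α.code (β.code ++ z) ↔ α = β := by
  constructor
  · rintro ⟨w, h, hw⟩
    exact (Formula.code_injective (append_inj_of_ends (fun _ => Formula.isFormula_of_mem_code)
      (fun _ => Formula.isFormula_of_mem_code) hz hw h)).symm
  · rintro rfl
    exact ⟨z, rfl, hz⟩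

theorem occurs_append {x y z : List Symbol} (hy : .arrow ∉ y) :
    Occurs x (y ++ z) ↔ Occurs x z := by
  induction y with
  | nil => rfl
  | cons a y ih =>
    simp only [List.mem_cons, not_or] at hy
    simp [Occurs, Ne.symm hy.1, ih hy.2]

theorem Formula.arrow_notMem_code (α : Formula) : .arrow ∉ α.code := fun h => by
  have := isFormula_of_mem_code h
  simp [Symbol.isFormula] at this

theorem arrow_notMem_itemsCode (l : List Formula) : .arrow ∉ itemsCode l := by
  simp [itemsCode, Formula.arrow_notMem_code]

/-- The formulas of a list, each introduced by an arrow. -/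
def baseCode (G : List Formula) : List Symbol := G.flatMap fun γ => .arrow :: γ.code

/-- The string of a stack of activated sequents over a list of formulas. -/
def stackCode (G : List Formula) (Y : List ListSequent) : List Symbol :=
  Y.flatMap (fun s => .ruleInit :: s.code) ++ baseCode G

theorem ends_baseCode (G : List Formula) : Ends (baseCode G) := by
  cases G <;> simp [baseCode, Symbol.isFormula]

theorem ends_stackCode (G : List Formula) (Y : List ListSequent) : Ends (stackCode G Y) := by
  cases Y with
  | nil => exact ends_baseCode G
  | cons s Y => simp [stackCode, Symbol.isFormula]

theorem occurs_arrow_code {α β : Formula} {z : List Symbol} (hz : Ends z) :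
    Occurs α.code (.arrow :: (β.code ++ z)) ↔ β = α ∨ Occurs α.code z := by
  rw [Occurs, occurs_append β.arrow_notMem_code, isItem_code hz]
  simp [eq_comm]

/-- A written sequent has exactly one arrow, directly before its succedent, and the formulas of `G`
are given an arrow of their own. One search therefore covers both ways of being known, and
antecedents of activated sequents cannot match. -/
theorem occurs_stackCode {G : List Formula} {Y : List ListSequent} {α : Formula} :
    Occurs α.code (stackCode G Y) ↔ Known G Y α := by
  induction Y with
  | nil =>
    simp only [Known, List.not_mem_nil, false_and, exists_false, or_false]
    induction G with
    | nil => simp [stackCode, baseCode, Occurs]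
    | cons γ G ih =>
      have h : stackCode (γ :: G) [] = .arrow :: (γ.code ++ stackCode G []) := by
        simp [stackCode, baseCode]
      rw [h, occurs_arrow_code (ends_stackCode G []), ih, List.mem_cons, eq_comm]
  | cons s Y ih =>
    have h : stackCode G (s :: Y) =
        (.ruleInit :: itemsCode s.1) ++ .arrow :: (s.2.code ++ stackCode G Y) := by
      simp [stackCode, ListSequent.code]
    rw [h, occurs_append (by simp [arrow_notMem_itemsCode]),
      occurs_arrow_code (ends_stackCode G Y), ih]
    simp only [Known, List.exists_mem_cons_iff]
    tauto

/-! ### The program -/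

/-- The stacks of the program. -/
inductive Stk : Type
  | W | V | N | A | B | X | Y | R | P | Q | T | F | H | G₀ | G₁ | D | I | E | C | O
  deriving DecidableEq

instance : Fintype Stk :=
  ⟨{.W, .V, .N, .A, .B, .X, .Y, .R, .P, .Q, .T, .F, .H, .G₀, .G₁, .D, .I, .E, .C, .O},
    fun x => by cases x <;> decide⟩

namespace StackProg

/-! ### Comparing and finding formula strings. -/

/-- Mark the stack `F` if the formula string on `X` starts the stack `y`. -/
def compare (y : Stk) : StackProg Stk Symbol :=
  .loop (fun τ => τ .X = τ y && (τ .X).any Symbol.isFormula) (move .X .P ;; move y .Q) ;;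
  .ite (fun τ => τ .X = none && !(τ y).any Symbol.isFormula) (put .F .one) .skip ;;
  .loop (fun τ => (τ .P).isSome) (move .P .X ;; move .Q y)

/-- The stacks used by `compare` differ from `y`. -/
def Comparable (y : Stk) : Prop := y ≠ .X ∧ y ≠ .P ∧ y ≠ .Q ∧ y ≠ .F

/-- The loop strips a common prefix `u` off both stacks, stopping at the first difference or at the
end of `X`; the parts removed are kept reversed on `P` and `Q`. -/
theorem runs_compare_fst {y : Stk} (hy : Comparable y) {S : Stk → List Symbol}
    (hX : ∀ a ∈ S .X, a.isFormula = true) :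
    ∃ u v w, S .X = u ++ v ∧ S y = u ++ w ∧ (v = [] ∨ v.head? ≠ w.head?) ∧
      Runs (.loop (fun τ => τ .X = τ y && (τ .X).any Symbol.isFormula)
        (move .X .P ;; move y .Q)) S
        (update (update (update (update S .X v) y w) .P (u.reverse ++ S .P)) .Q
          (u.reverse ++ S .Q)) (5 * (S .X).length + 1) := by
  obtain ⟨h₁, h₂, h₃, h₄⟩ := hy
  generalize hl : S .X = l
  induction l generalizing S with
  | nil =>
    refine ⟨[], [], S y, rfl, rfl, Or.inl rfl, (Runs.loop_false ?_).congr ?_ (by simp)⟩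
    · simp [tops, hl]
    · funext k
      simp only [update_apply]
      split_ifs <;> simp_all
  | cons a l ih =>
    by_cases ha : (S y).head? = some a
    · obtain ⟨w, hw⟩ : ∃ w, S y = a :: w := by
        cases h : S y with
        | nil => simp [h] at ha
        | cons b w => simp [h] at ha; exact ⟨w, by rw [ha]⟩
      have m₁ := runs_move (a := Stk.X) (b := .P) (by decide) hl
      have m₂ := runs_move (S := update (update S .X l) .P (a :: S .P)) (a := y) (b := .Q) h₃
        (c := a) (l := w) (by simp [h₁, h₂, hw])
      obtain ⟨u, v, w', e₁, e₂, e₃, e₄⟩ := ih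
        (S := update (update (update (update S .X l) .P (a :: S .P)) y w) .Q (a :: S .Q))
        (by
          have : ∀ b ∈ l, b.isFormula = true := fun b hb => hX b (by simp [hl, hb])
          simpa [h₁.symm] using this) (by simp [h₁.symm])
      refine ⟨a :: u, v, w', by simp [e₁], ?_, e₃,
        (Runs.loop_true ?_ (m₁.seq (m₂.congr ?_ le_rfl)) e₄).congr ?_ ?_⟩
      · simpa [h₃, hw] using e₂
      · simp [tops, hl, hw, hX a (by simp [hl])]
      · simp
      · funext k
        simp only [update_apply]
        split_ifs <;> simp_all
      · simp only [List.length_cons]; omega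
    · refine ⟨[], a :: l, S y, rfl, rfl, Or.inr fun h => ha h.symm,
        (Runs.loop_false ?_).congr ?_ (by simp)⟩
      · have : some a ≠ (S y).head? := fun h => ha h.symm
        simp [tops, hl, this]
      · funext k
        simp only [update_apply]
        split_ifs <;> simp_all

/-- Undoes the stripping. The loop is governed by `P` alone, so `Q` may hold further symbols `q`
below the prefix. -/
theorem runs_compare_snd {y : Stk} (hy : Comparable y) {S : Stk → List Symbol}
    {u q : List Symbol} (hP : S .P = u) (hQ : S .Q = u ++ q) :
    Runs (.loop (fun τ => (τ .P).isSome) (move .P .X ;; move .Q y)) S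
      (update (update (update (update S .P []) .Q q) .X (u.reverse ++ S .X)) y
        (u.reverse ++ S y)) (5 * u.length + 1) := by
  obtain ⟨h₁, h₂, h₃, h₄⟩ := hy
  induction u generalizing S with
  | nil =>
    refine (Runs.loop_false (by simp [tops, hP])).congr ?_ (by simp)
    funext k
    simp only [update_apply]
    split_ifs <;> simp_all
  | cons a u ih =>
    have m₁ := runs_move (a := Stk.P) (b := .X) (by decide) hP
    have m₂ := runs_move (S := update (update S .P u) .X (a :: S .X)) (a := .Q) (b := y) h₃.symm
      (c := a) (l := u ++ q) (by simp [hQ])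
    refine (Runs.loop_true (by simp [tops, hP]) (m₁.seq m₂) (ih ?_ ?_)).congr ?_ ?_
    · simp [h₂.symm]
    · simp [h₃.symm]
    · funext k
      simp only [update_apply]
      split_ifs <;> simp_all
    · simp only [List.length_cons]; omega

theorem runs_compare {y : Stk} (hy : Comparable y) {S : Stk → List Symbol}
    (hX : ∀ a ∈ S .X, a.isFormula = true) (hP : S .P = []) :
    ∃ f, (f = [] ↔ S .F = [] ∧ ¬ IsItem (S .X) (S y)) ∧ f.length ≤ (S .F).length + 1 ∧
      Runs (compare y) S (update S .F f) (10 * (S .X).length + 5) := by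
  obtain ⟨u, v, w, e₁, e₂, e₃, r₁⟩ := runs_compare_fst hy hX
  have hy' := hy
  obtain ⟨h₁, h₂, h₃, h₄⟩ := hy'
  have hlen : u.length ≤ (S .X).length := by rw [e₁]; simp
  -- A match means that the formula on `X` is used up and the rest of `y` does not continue a
  -- formula.
  by_cases h : v = [] ∧ Ends w
  · refine ⟨.one :: S .F, ?_, by simp, (r₁.seq ((Runs.ite_true ?_ runs_put).seq
      (runs_compare_snd hy (u := u.reverse) (q := S .Q) ?_ ?_))).congr ?_ ?_⟩
    · have : IsItem (S .X) (S y) := ⟨w, by rw [e₁, e₂, h.1]; simp, h.2⟩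
      simp [this]
    · have h' := h.2
      cases w with
      | nil => simp [tops, h₁.symm, h₃, h₂, h.1]
      | cons c w => simp at h'; simp [tops, h₁.symm, h₃, h₂, h.1, h']
    · simp [hP]
    · simp
    · funext k
      simp only [update_apply]
      split_ifs <;> simp_all
    · simp; omega
  · refine ⟨S .F, ?_, by simp, (r₁.seq ((Runs.ite_false ?_ Runs.skip).seq
      (runs_compare_snd hy (u := u.reverse) (q := S .Q) ?_ ?_))).congr ?_ ?_⟩
    · have : ¬ IsItem (S .X) (S y) := by
        rintro ⟨z, hz, hz'⟩
        rw [e₁, e₂, List.append_assoc, List.append_cancel_left_eq] at hz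
        subst hz
        rcases e₃ with rfl | e₃
        · exact h ⟨rfl, hz'⟩
        · cases v <;> simp_all
      simp [this]
    · cases v with
      | nil =>
        cases w with
        | nil => simp at h
        | cons c w => simp at h; simp [tops, h₁.symm, h₃, h₂, h]
      | cons c v => simp [tops, h₁.symm]
    · simp [hP]
    · simp
    · funext k
      simp only [update_apply]
      split_ifs <;> simp_all
    · simp; omega

/-- Mark the stack `F` for every occurrence, introduced by an arrow, of the formula string on `X`
in the stack `Y`. -/
def find : StackProg Stk Symbol :=
  .loop (fun τ => (τ .Y).isSome)
    (move .Y .R ;; .ite (fun τ => τ .R = some .arrow) (compare .Y) .skip) ;;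
  moveAll .R .Y

theorem runs_find_loop {S : Stk → List Symbol} (hX : ∀ a ∈ S .X, a.isFormula = true)
    (hP : S .P = []) :
    ∃ f, (f = [] ↔ S .F = [] ∧ ¬ Occurs (S .X) (S .Y)) ∧
      f.length ≤ (S .F).length + (S .Y).length ∧
      Runs (.loop (fun τ => (τ .Y).isSome)
        (move .Y .R ;; .ite (fun τ => τ .R = some .arrow) (compare .Y) .skip)) S
        (update (update (update S .Y []) .R ((S .Y).reverse ++ S .R)) .F f)
        ((S .Y).length * (10 * (S .X).length + 9) + 1) := by
  generalize hl : S .Y = l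
  generalize hn : (S .X).length = n
  induction l generalizing S with
  | nil =>
    refine ⟨S .F, by simp [Occurs], by simp, (Runs.loop_false (by simp [tops, hl])).congr ?_ (by simp)⟩
    funext k
    simp only [update_apply]
    split_ifs <;> simp_all
  | cons a l ih =>
    have m := runs_move (a := Stk.Y) (b := .R) (by decide) hl
    obtain ⟨f, hf, hfl, r⟩ : ∃ f, (f = [] ↔ S .F = [] ∧ ¬ (a = .arrow ∧ IsItem (S .X) l)) ∧
        f.length ≤ (S .F).length + 1 ∧
        Runs (.ite (fun τ => τ .R = some .arrow) (compare .Y) .skip)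
          (update (update S .Y l) .R (a :: S .R))
          (update (update (update S .Y l) .R (a :: S .R)) .F f) (10 * n + 6) := by
      by_cases ha : a = .arrow
      · obtain ⟨f, hf, hfl, r⟩ := runs_compare (y := .Y) (by simp [Comparable])
          (S := update (update S .Y l) .R (a :: S .R)) (by simpa using hX) (by simpa using hP)
        refine ⟨f, by simpa [ha] using hf, by simpa using hfl,
          (Runs.ite_true (by simp [tops, ha]) r).congr rfl ?_⟩
        simp [hn]
      · refine ⟨S .F, by simp [ha], by simp, (Runs.ite_false (by simp [tops, ha]) Runs.skip).congr ?_ ?_⟩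
        · funext k
          simp only [update_apply]
          split_ifs <;> simp_all
        · omega
    obtain ⟨f', hf', hfl', r'⟩ := ih (S := update (update (update S .Y l) .R (a :: S .R)) .F f)
      (by simpa using hX) (by simpa using hP) (by simp) (by simpa using hn)
    refine ⟨f', ?_, ?_, (Runs.loop_true (by simp [tops, hl]) (m.seq r) r').congr ?_ ?_⟩
    · rw [hf']
      simp only [update_self, hf, Occurs]
      simp
      tauto
    · simp only [update_self] at hfl'
      rw [List.length_cons]
      omega
    · funext k
      simp only [update_apply]
      split_ifs <;> simp_all
    · simp only [List.length_cons, Nat.succ_mul]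
      omega

theorem runs_find {S : Stk → List Symbol} (hX : ∀ a ∈ S .X, a.isFormula = true)
    (hP : S .P = []) (hR : S .R = []) :
    ∃ f, (f = [] ↔ S .F = [] ∧ ¬ Occurs (S .X) (S .Y)) ∧
      f.length ≤ (S .F).length + (S .Y).length ∧
      Runs find S (update S .F f) ((S .Y).length * (10 * (S .X).length + 12) + 2) := by
  obtain ⟨f, hf, hfl, r⟩ := runs_find_loop hX hP
  refine ⟨f, hf, hfl, (r.seq (runs_moveAll (by decide))).congr ?_ ?_⟩
  · funext k
    cases k <;> simp [hR]
  · simp [hR, Nat.mul_add]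
    omega

/-! ### Testing whether every formula of a list is known. -/

@[simp] theorem itemsCode_nil : itemsCode [] = [] := rfl

@[simp] theorem itemsCode_cons (α : Formula) (l : List Formula) :
    itemsCode (α :: l) = α.code ++ .comma :: itemsCode l := by
  simp [itemsCode]

theorem itemsCode_append (l l' : List Formula) :
    itemsCode (l ++ l') = itemsCode l ++ itemsCode l' := by
  simp [itemsCode]

/-- Mark the stack `H` if some formula of the list on `B` does not occur on `Y`. -/
def testItems : StackProg Stk Symbol :=
  .loop (fun τ => (τ .B).isSome)
    (take Symbol.isFormula .B .X .T ;; .pop .B ;; find ;;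
      .ite (fun τ => (τ .F).isSome) .skip (put .H .one) ;; clear .F ;; clear .X)

theorem runs_testItems {l : List Formula} {S : Stk → List Symbol} (hB : S .B = itemsCode l)
    (hX : S .X = []) (hT : S .T = []) (hF : S .F = []) (hP : S .P = []) (hR : S .R = []) :
    ∃ h, (h = [] ↔ S .H = [] ∧ ∀ α ∈ l, Occurs α.code (S .Y)) ∧
      h.length ≤ (S .H).length + l.length ∧
      Runs testItems S (update (update S .B []) .H h)
        ((itemsCode l).length * (14 * (S .Y).length + 20) + 1) := by
  generalize hn : (S .Y).length = n
  induction l generalizing S with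
  | nil =>
    refine ⟨S .H, by simp, by simp, (Runs.loop_false (by simp [tops, hB])).congr ?_ (by simp)⟩
    funext k
    cases k <;> simp [hB]
  | cons α l ih =>
    rw [itemsCode_cons] at hB
    have r₁ := runs_take (a := Stk.B) (b := .X) (t := .T) (by decide) (by decide) (by decide) hT
      hB (p := Symbol.isFormula) (fun _ => Formula.isFormula_of_mem_code)
      (by simp [Symbol.isFormula])
    have r₂ := runs_pop (S := update (update S .B (.comma :: itemsCode l)) .X (α.code ++ S .X))
      (a := .B) (c := .comma) (l := itemsCode l) (by simp)
    obtain ⟨f, hf, hfl, r₃⟩ := runs_find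
      (S := update (update S .B (itemsCode l)) .X α.code)
      (by simpa using fun _ => Formula.isFormula_of_mem_code) (by simpa using hP)
      (by simpa using hR)
    obtain ⟨h, hh, hhl, r₄⟩ : ∃ h, (h = [] ↔ S .H = [] ∧ Occurs α.code (S .Y)) ∧
        h.length ≤ (S .H).length + 1 ∧
        Runs (.ite (fun τ => (τ .F).isSome) .skip (put .H .one))
          (update (update (update S .B (itemsCode l)) .X α.code) .F f)
          (update (update (update (update S .B (itemsCode l)) .X α.code) .F f) .H h) 2 := by
      simp only [ne_eq, reduceCtorEq, not_false_eq_true, update_of_ne, update_self, hF,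
        true_and] at hf
      by_cases hf0 : f = []
      · refine ⟨.one :: S .H, ?_, by simp, (Runs.ite_false ?_ runs_put).congr ?_ le_rfl⟩
        · simp [hf.mp hf0]
        · simp [tops, hf0]
        · simp
      · refine ⟨S .H, ?_, by simp, (Runs.ite_true ?_ Runs.skip).congr ?_ le_rfl⟩
        · rw [hf, not_not] at hf0
          simp [hf0]
        · simpa [tops] using hf0
        · funext k
          cases k <;> simp
    obtain ⟨h', hh', hhl', r₅⟩ := ih (S := update (update S .B (itemsCode l)) .H h) (by simp)
      (by simpa using hX) (by simpa using hT) (by simpa using hF) (by simpa using hP)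
      (by simpa using hR) (by simpa using hn)
    refine ⟨h', ?_, ?_, (Runs.loop_true (by simp [tops, hB]) (r₁.seq (r₂.seq ((r₃.congr_start ?_).seq
      (r₄.seq (runs_clear.seq runs_clear))))) (r₅.congr_start ?_)).congr ?_ ?_⟩
    · simp [hh', hh, and_assoc]
    · simp at hhl' ⊢
      omega
    · funext k
      cases k <;> simp [hX]
    · funext k
      cases k <;> simp [hX, hF]
    · funext k
      cases k <;> simp
    · simp [hn, hF] at hfl ⊢
      nlinarith
-- Loading, writing and filtering sequents.
/-- Take the rule name and the antecedent off the stack `y` and put the antecedent on `A`. -/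
def loadAnte (y : Stk) : StackProg Stk Symbol :=
  .pop y ;; take (fun a => a ≠ .arrow) y .A .T ;; .pop y

/-- Take the succedent off the stack `y` and put it on `X`. -/
def loadSucc (y : Stk) : StackProg Stk Symbol := take Symbol.isFormula y .X .T

/-- Push the sequent on the stacks `A` and `X`, introduced by a rule name, onto the stack `o`. -/
def emit (o : Stk) : StackProg Stk Symbol :=
  copy .X o .T ;; put o .arrow ;; copy .A o .T ;; put o .ruleInit

theorem runs_loadAnte {y : Stk} (hA : y ≠ .A) (hyT : y ≠ .T) {S : Stk → List Symbol}
    (hT : S .T = []) (hSA : S .A = []) {r : Symbol} {l : List Formula} {z : List Symbol}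
    (hy : S y = r :: (itemsCode l ++ .arrow :: z)) :
    Runs (loadAnte y) S (update (update S y z) .A (itemsCode l))
      (6 * (itemsCode l).length + 4) := by
  have r₁ := runs_pop hy
  have r₂ := runs_take (S := update S y (itemsCode l ++ .arrow :: z)) (a := y) (b := .A) (t := .T)
    (p := fun a => a ≠ .arrow) (x := itemsCode l) (z := .arrow :: z) hyT (by decide) hA
    (by simpa [hyT.symm] using hT) (by simp)
    (fun c hc => by
      simp only [ne_eq, decide_eq_true_eq]
      rintro rfl
      exact arrow_notMem_itemsCode l hc) (by simp)
  have r₃ := runs_pop (S := update (update S y (.arrow :: z)) .A (itemsCode l)) (a := y)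
    (c := .arrow) (l := z) (by simp [hA])
  refine (r₁.seq (r₂.seq (r₃.congr_start ?_))).congr ?_ ?_
  · funext k
    simp only [update_apply]
    split_ifs <;> simp_all
  · funext k
    simp only [update_apply]
    split_ifs <;> simp_all
  · omega

theorem runs_loadSucc {y : Stk} (hX : y ≠ .X) (hyT : y ≠ .T) {S : Stk → List Symbol}
    (hT : S .T = []) (hSX : S .X = []) {β : Formula} {z : List Symbol} (hz : Ends z)
    (hy : S y = β.code ++ z) :
    Runs (loadSucc y) S (update (update S y z) .X β.code) (6 * β.code.length + 2) := by
  refine (runs_take hyT (by decide) hX hT hy (fun _ => Formula.isFormula_of_mem_code) hz).congr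
    (by rw [hSX, List.append_nil]) le_rfl

theorem runs_emit {o : Stk} (hA : o ≠ .A) (hX : o ≠ .X) (hoT : o ≠ .T) {S : Stk → List Symbol}
    (hT : S .T = []) {s : ListSequent} (hSA : S .A = itemsCode s.1) (hSX : S .X = s.2.code) :
    Runs (emit o) S (update S o (.ruleInit :: (s.code ++ S o)))
      (7 * s.code.length + 6) := by
  have r₁ := runs_copy (S := S) (a := .X) (b := o) (t := .T) (by decide) hoT hX.symm hT
  have r₂ := runs_put (S := update S o (S .X ++ S o)) (a := o) (c := .arrow)
  have r₃ := runs_copy (S := update S o (.arrow :: (S .X ++ S o))) (a := .A) (b := o) (t := .T)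
    (by decide) hoT hA.symm (by simpa [hoT.symm] using hT)
  have r₄ := runs_put (S := update S o (S .A ++ .arrow :: (S .X ++ S o))) (a := o)
    (c := .ruleInit)
  refine (r₁.seq (r₂.seq ((r₃.congr_start ?_).seq (r₄.congr_start ?_)))).congr ?_ ?_
  · simp
  · simp [hA.symm]
  · simp [hSA, hSX, ListSequent.code]
  · simp [hSA, hSX, ListSequent.code, hA.symm]
    omega

/-- Remove the formula on `X` from the list on `C`; mark the stack `H` if it occurs there. -/
def filter : StackProg Stk Symbol :=
  .loop (fun τ => (τ .C).isSome)
    (compare .C ;;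
      .ite (fun τ => (τ .F).isSome)
        (put .H .one ;; clear .F ;; dropWhile Symbol.isFormula .C ;; .pop .C)
        (moveWhile Symbol.isFormula .C .B ;; move .C .B)) ;;
  moveAll .B .C

theorem runs_filter_loop {β : Formula} {l : List Formula} {S : Stk → List Symbol}
    (hC : S .C = itemsCode l) (hX : S .X = β.code) (hF : S .F = []) (hP : S .P = []) :
    ∃ h, (h = [] ↔ S .H = [] ∧ β ∉ l) ∧ h.length ≤ (S .H).length + l.length ∧
      Runs (.loop (fun τ => (τ .C).isSome)
        (compare .C ;;
          .ite (fun τ => (τ .F).isSome)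
            (put .H .one ;; clear .F ;; dropWhile Symbol.isFormula .C ;; .pop .C)
            (moveWhile Symbol.isFormula .C .B ;; move .C .B))) S
        (update (update (update S .C []) .B
          ((itemsCode (l.filter (· ≠ β))).reverse ++ S .B)) .H h)
        ((itemsCode l).length * (10 * β.code.length + 13) + 1) := by
  induction l generalizing S with
  | nil =>
    refine ⟨S .H, by simp, by simp, (Runs.loop_false (by simp [tops, hC])).congr ?_ (by simp)⟩
    funext k
    cases k <;> simp [hC]
  | cons α l ih =>
    rw [itemsCode_cons] at hC
    obtain ⟨f, hf, hfl, r₁⟩ := runs_compare (y := .C) (by simp [Comparable]) (S := S)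
      (by rw [hX]; exact fun _ => Formula.isFormula_of_mem_code) hP
    rw [hC, hX, isItem_code (by simp [Symbol.isFormula])] at hf
    simp only [hF, true_and] at hf
    by_cases hαβ : α = β
    · have hf' : f ≠ [] := fun h => hf.mp h hαβ.symm
      have r₂ := runs_dropWhile (S := update (update S .H (.one :: S .H)) .F []) (a := .C)
        (p := Symbol.isFormula) (x := α.code) (z := .comma :: itemsCode l) (by simpa using hC)
        (fun _ => Formula.isFormula_of_mem_code) (by simp [Symbol.isFormula])
      have r₃ := runs_pop (S := update (update (update S .H (.one :: S .H)) .F []) .C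
        (.comma :: itemsCode l)) (a := .C) (c := .comma) (l := itemsCode l) (by simp)
      obtain ⟨h, hh, hhl, r₄⟩ := ih (S := update (update S .H (.one :: S .H)) .C (itemsCode l))
        (by simp) (by simpa using hX) (by simpa using hF) (by simpa using hP)
      refine ⟨h, ?_, ?_, (Runs.loop_true (by simp [tops, hC]) (r₁.seq (Runs.ite_true ?_
        (runs_put.seq (runs_clear.seq ((r₂.congr_start ?_).seq r₃)))))
        (r₄.congr_start ?_)).congr ?_ ?_⟩
      · rw [hh]
        simp [hαβ]
      · simp at hhl ⊢
        omega
      · cases f <;> simp_all [tops]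
      · funext k
        cases k <;> simp
      · funext k
        cases k <;> simp [hF]
      · funext k
        cases k <;> simp [hαβ]
      · simp [hF, hX] at hfl ⊢
        nlinarith
    · have hf' : f = [] := hf.mpr fun h => hαβ h.symm
      have r₂ := runs_moveWhile (S := S) (a := .C) (b := .B) (by decide)
        (p := Symbol.isFormula) (x := α.code) (z := .comma :: itemsCode l) hC
        (fun _ => Formula.isFormula_of_mem_code) (by simp [Symbol.isFormula])
      have r₃ := runs_move (S := update (update S .C (.comma :: itemsCode l)) .B
        (α.code.reverse ++ S .B)) (a := .C) (b := .B) (by decide) (c := .comma)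
        (l := itemsCode l) (by simp)
      obtain ⟨h, hh, hhl, r₄⟩ := ih
        (S := update (update S .B (.comma :: (α.code.reverse ++ S .B))) .C (itemsCode l))
        (by simp) (by simpa using hX) (by simpa using hF) (by simpa using hP)
      refine ⟨h, ?_, ?_, (Runs.loop_true (by simp [tops, hC]) (r₁.seq (Runs.ite_false ?_
        ((r₂.congr_start ?_).seq r₃))) (r₄.congr_start ?_)).congr ?_ ?_⟩
      · rw [hh]
        simp [Ne.symm hαβ]
      · simp at hhl ⊢
        omega
      · simp [tops, hf']
      · funext k
        cases k <;> simp [hf', hF]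
      · funext k
        cases k <;> simp
      · funext k
        cases k <;> simp [hαβ]
      · simp [hX]
        nlinarith

theorem runs_filter {β : Formula} {l : List Formula} {S : Stk → List Symbol}
    (hC : S .C = itemsCode l) (hX : S .X = β.code) (hF : S .F = []) (hP : S .P = [])
    (hB : S .B = []) (hH : S .H = []) :
    ∃ h, (h = [] ↔ β ∉ l) ∧ h.length ≤ l.length ∧
      Runs filter S (update (update S .C (itemsCode (l.filter (· ≠ β)))) .H h)
        ((itemsCode l).length * (10 * β.code.length + 16) + 2) := by
  obtain ⟨h, hh, hhl, r⟩ := runs_filter_loop hC hX hF hP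
  have hlen : (itemsCode (l.filter (· ≠ β))).length ≤ (itemsCode l).length :=
    (List.Sublist.flatMap List.filter_sublist _).length_le
  refine ⟨h, by simpa [hH] using hh, by simpa [hH] using hhl,
    (r.seq (runs_moveAll (by decide))).congr ?_ ?_⟩
  · funext k
    cases k <;> simp [hB]
  · simp [hB] at hlen ⊢
    nlinarith

/-! ### Forward chaining on the stacks. -/

/-- Activate the next sequent on `V`, if its antecedent is known. -/
def activateNext : StackProg Stk Symbol :=
  loadAnte .V ;; copy .A .B .T ;; testItems ;; loadSucc .V ;;
    .ite (fun τ => (τ .H).isSome) .skip (emit .Y) ;; clear .A ;; clear .X ;; clear .H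

/-- The scratch stacks are empty. -/
def Clean (S : Stk → List Symbol) : Prop :=
  S .A = [] ∧ S .B = [] ∧ S .X = [] ∧ S .T = [] ∧ S .F = [] ∧ S .P = [] ∧ S .R = [] ∧ S .H = []

theorem length_le_length_itemsCode (l : List Formula) : l.length ≤ (itemsCode l).length := by
  induction l with
  | nil => simp
  | cons α l ih => simp; omega

theorem runs_activateNext {S : Stk → List Symbol} (hS : Clean S) {r : Symbol} {s : ListSequent}
    {v : List Symbol} (hV : S .V = r :: (s.code ++ v)) (hv : Ends v) {G : List Formula}
    {Y : List ListSequent} (hY : S .Y = stackCode G Y) :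
    Runs activateNext S (update (update S .V v) .Y (stackCode G (activate G Y s)))
      (s.code.length * (14 * (S .Y).length + 52) + 20) := by
  obtain ⟨hA, hB, hX, hT, hF, hP, hR, hH⟩ := hS
  have hlen : s.code.length = (itemsCode s.1).length + 1 + s.2.code.length := by
    simp [ListSequent.code]
    omega
  have r₁ := runs_loadAnte (y := .V) (by decide) (by decide) (r := r) (l := s.1) (z := s.2.code ++ v) hT hA
    (by rw [hV]; simp [ListSequent.code])
  have r₂ := runs_copy (S := update (update S .V (s.2.code ++ v)) .A (itemsCode s.1))
    (a := .A) (b := .B) (t := .T) (by decide) (by decide) (by decide) (by simpa using hT)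
  obtain ⟨h, hh, hhl, r₃⟩ := runs_testItems (l := s.1)
    (S := update (update (update S .V (s.2.code ++ v)) .A (itemsCode s.1)) .B (itemsCode s.1))
    (by simp) (by simpa using hX) (by simpa using hT) (by simpa using hF) (by simpa using hP)
    (by simpa using hR)
  have r₄ := runs_loadSucc (y := .V) (β := s.2) (z := v)
    (S := update (update (update S .V (s.2.code ++ v)) .A (itemsCode s.1)) .H h)
    (by decide) (by decide) (by simpa using hT) (by simpa using hX) hv (by simp)
  obtain r₅ : Runs (.ite (fun τ => (τ .H).isSome) .skip (emit .Y))
      (update (update (update (update S .V v) .A (itemsCode s.1)) .H h) .X s.2.code)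
      (update (update (update (update (update S .V v) .A (itemsCode s.1)) .H h) .X s.2.code) .Y
        (stackCode G (activate G Y s))) (7 * s.code.length + 7) := by
    -- Here the string test becomes the mathematical condition: no item failed exactly when the
    -- whole antecedent is known.
    have hready : h = [] ↔ Ready G Y s := by
      rw [hh]
      simp [hH, hY, occurs_stackCode, Ready]
    by_cases hr : h = []
    · refine (Runs.ite_false (by simp [tops, hr]) (runs_emit (s := s) (by decide) (by decide)
        (by decide) (by simpa using hT) (by simp) (by simp))).congr ?_ le_rfl
      funext k
      cases k <;> simp [activate, hready.mp hr, hY, stackCode]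
    · refine (Runs.ite_true ?_ Runs.skip).congr ?_ ?_
      · simpa [tops] using hr
      · rw [hready] at hr
        funext k
        cases k <;> simp [activate, hr, hY]
      · omega
  refine (r₁.seq ((r₂.congr rfl le_rfl).seq ((r₃.congr_start ?_).seq ((r₄.congr_start ?_).seq
    ((r₅.congr_start ?_).seq (runs_clear.seq (runs_clear.seq runs_clear))))))).congr ?_ ?_
  · funext k
    cases k <;> simp [hB]
  · funext k
    cases k <;> simp [hB]
  · funext k
    cases k <;> simp
  · funext k
    cases k <;> simp [hA, hX, hH]
  · have := length_le_length_itemsCode s.1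
    simp [hH] at hhl ⊢
    rw [hlen]
    nlinarith

/-- One pass of activations through the sequents on `W`. -/
def runPass : StackProg Stk Symbol :=
  copy .W .V .T ;; .loop (fun τ => (τ .V).isSome) activateNext

theorem ends_flatMap_ruleCode {M : List (Symbol × ListSequent)}
    (hM : ∀ e ∈ M, e.1.isRule = true) : Ends (M.flatMap ruleCode) := by
  cases M with
  | nil => simp
  | cons e M =>
    simp [ruleCode, Symbol.isFormula_eq_false_of_isRule (hM e (by simp))]

theorem length_stackCode_activate (G : List Formula) (Y : List ListSequent) (s : ListSequent) :
    (stackCode G (activate G Y s)).length ≤ s.code.length + 1 + (stackCode G Y).length := by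
  unfold activate
  split_ifs
  · simp [stackCode]
  · omega

/-- Each sequent is pushed at most once per pass, with `ruleInit` replacing its rule name. The
growth is additive in the input length, so iterating passes does not blow up the stack. -/
theorem length_stackCode_pass (G : List Formula) (M : List (Symbol × ListSequent))
    (Y : List ListSequent) :
    (stackCode G (pass G (M.map Prod.snd) Y)).length ≤
      (M.flatMap ruleCode).length + (stackCode G Y).length := by
  induction M generalizing Y with
  | nil => simp [pass]
  | cons e M ih =>
    have h₁ := ih (activate G Y e.2)
    have h₂ := length_stackCode_activate G Y e.2
    simp only [List.flatMap_cons, List.length_append, ruleCode, List.length_cons, pass,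
      List.map_cons, List.foldl_cons] at h₁ ⊢
    omega

/-- The bound `n` on unread input plus activated string survives each iteration, since a sequent
leaving `V` lengthens `Y` by at most what `V` loses. -/
theorem runs_runPass_loop {G : List Formula} {M : List (Symbol × ListSequent)}
    (hM : ∀ e ∈ M, e.1.isRule = true) {S : Stk → List Symbol} (hS : Clean S)
    (hV : S .V = M.flatMap ruleCode) {Y : List ListSequent} (hY : S .Y = stackCode G Y) {n : ℕ}
    (hn : (S .V).length + (S .Y).length ≤ n) :
    Runs (.loop (fun τ => (τ .V).isSome) activateNext) S
      (update (update S .V []) .Y (stackCode G (pass G (M.map Prod.snd) Y)))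
      ((S .V).length * (14 * n + 52) + 1) := by
  induction M generalizing S Y with
  | nil =>
    refine (Runs.loop_false (by simp [tops, hV])).congr ?_ (by simp)
    funext k
    cases k <;> simp [hV, hY, pass]
  | cons e M ih =>
    have hM' : ∀ x ∈ M, x.1.isRule = true := fun x hx => hM x (List.mem_cons_of_mem _ hx)
    have hV' : S .V = e.1 :: (e.2.code ++ M.flatMap ruleCode) := by
      rw [hV]; simp [ruleCode]
    have hlen := length_stackCode_activate G Y e.2
    rw [← hY] at hlen
    have r₁ := runs_activateNext hS hV' (ends_flatMap_ruleCode hM') hY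
    have r₂ := ih hM' (Y := activate G Y e.2) (S := update (update S .V (M.flatMap ruleCode)) .Y
      (stackCode G (activate G Y e.2))) (by simpa [Clean] using hS) (by simp) (by simp)
      (by simp [hV'] at hn ⊢; omega)
    refine (Runs.loop_true (by simp [tops, hV']) r₁ r₂).congr ?_ ?_
    · funext k
      cases k <;> simp [pass]
    · have h₁ : (S .Y).length ≤ n := by omega
      rw [hV'] at hn ⊢
      simp only [List.length_cons, List.length_append, ne_eq, reduceCtorEq, not_false_eq_true,
        update_of_ne, update_self] at hn ⊢
      have h₂ : e.2.code.length * (14 * (S .Y).length + 52) ≤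
        e.2.code.length * (14 * n + 52) := Nat.mul_le_mul_left _ (by omega)
      nlinarith

theorem runs_runPass {G : List Formula} {M : List (Symbol × ListSequent)}
    (hM : ∀ e ∈ M, e.1.isRule = true) {S : Stk → List Symbol} (hS : Clean S) (hV : S .V = [])
    (hW : S .W = M.flatMap ruleCode) {Y : List ListSequent} (hY : S .Y = stackCode G Y) {n : ℕ}
    (hn : (S .W).length + (S .Y).length ≤ n) :
    Runs runPass S (update S .Y (stackCode G (pass G (M.map Prod.snd) Y)))
      ((S .W).length * (14 * n + 59) + 3) := by
  have hS' := hS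
  obtain ⟨hA, hB, hX, hT, hF, hP, hR, hH⟩ := hS'
  have r₁ := runs_copy (S := S) (a := .W) (b := .V) (t := .T) (by decide) (by decide) (by decide) hT
  have r₂ := runs_runPass_loop hM (S := update S .V (S .W)) (by simpa [Clean] using hS)
    (by simpa using hW) (by simpa using hY) (n := n) (by simpa using hn)
  refine (r₁.seq (r₂.congr_start ?_)).congr ?_ ?_
  · simp [hV]
  · funext k
    cases k <;> simp [hV]
  · simp only [update_self]
    nlinarith

/-- As many passes of activations as there are symbols on `N`. -/
def runPasses : StackProg Stk Symbol :=
  .loop (fun τ => (τ .N).isSome) (.pop .N ;; runPass)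

/-- The budget `n` reserves one input length for each pass still to be made, so one bound serves for
all passes. -/
theorem runs_runPasses {G : List Formula} {M : List (Symbol × ListSequent)}
    (hM : ∀ e ∈ M, e.1.isRule = true) {S : Stk → List Symbol} (hS : Clean S) (hV : S .V = [])
    (hW : S .W = M.flatMap ruleCode) {Y : List ListSequent} (hY : S .Y = stackCode G Y) {n : ℕ}
    (hn : (S .N).length * (S .W).length + (S .Y).length ≤ n) :
    Runs runPasses S (update (update S .N []) .Y
        (stackCode G ((pass G (M.map Prod.snd))^[(S .N).length] Y)))
      ((S .N).length * ((S .W).length * (14 * n + 59) + 5) + 1) := by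
  generalize hl : S .N = l
  induction l generalizing S Y with
  | nil =>
    refine (Runs.loop_false (by simp [tops, hl])).congr ?_ (by simp)
    funext k
    cases k <;> simp [hl, hY]
  | cons a l ih =>
    have hlen := length_stackCode_pass G M Y
    rw [← hY, ← hW] at hlen
    rw [hl, List.length_cons, Nat.succ_mul] at hn
    have r₁ := runs_pop hl
    have r₂ := runs_runPass hM (S := update S .N l) (by simpa [Clean] using hS)
      (by simpa using hV) (by simpa using hW) (by simpa using hY) (n := n)
      (by simp; omega)
    have r₃ := ih (Y := pass G (M.map Prod.snd) Y) (S := update (update S .N l) .Y (stackCode G (pass G (M.map Prod.snd) Y)))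
      (by simpa [Clean] using hS) (by simpa using hV) (by simpa using hW) (by simp)
      (by simp; omega) (by simp)
    refine (Runs.loop_true (by simp [tops, hl]) (r₁.seq r₂) r₃).congr ?_ ?_
    · funext k
      cases k <;> simp
    · simp only [List.length_cons, ne_eq, reduceCtorEq, not_false_eq_true, update_of_ne,
        Nat.succ_mul]
      omega

/-! ### Reading the end sequent -/

/-- Turn the list of formulas on `A` into the bottom of the stack `Y`. -/
def initKnown : StackProg Stk Symbol :=
  .loop (fun τ => (τ .A).isSome) (take Symbol.isFormula .A .Y .T ;; put .Y .arrow ;; .pop .A)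

theorem runs_initKnown {l G : List Formula} {S : Stk → List Symbol} (hA : S .A = itemsCode l)
    (hY : S .Y = baseCode G) (hT : S .T = []) :
    Runs initKnown S (update (update S .A []) .Y (baseCode (l.reverse ++ G)))
      (6 * (itemsCode l).length + 1) := by
  induction l generalizing S G with
  | nil =>
    refine (Runs.loop_false (by simp [tops, hA])).congr ?_ (by simp)
    funext k
    cases k <;> simp [hA, hY]
  | cons α l ih =>
    rw [itemsCode_cons] at hA
    have r₁ := runs_take (a := Stk.A) (b := .Y) (t := .T) (by decide) (by decide) (by decide) hT
      hA (p := Symbol.isFormula) (fun _ => Formula.isFormula_of_mem_code)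
      (by simp [Symbol.isFormula])
    have r₂ := runs_pop (S := update (update S .A (.comma :: itemsCode l)) .Y
      (.arrow :: (α.code ++ S .Y))) (a := .A) (c := .comma) (l := itemsCode l) (by simp)
    have r₃ := ih (G := α :: G) (S := update (update S .A (itemsCode l)) .Y
      (.arrow :: (α.code ++ S .Y))) (by simp) (by simp [hY, baseCode]) (by simpa using hT)
    refine (Runs.loop_true (by simp [tops, hA]) (r₁.seq (runs_put.seq (r₂.congr_start ?_)))
      (r₃.congr_start ?_)).congr ?_ ?_
    · simp
    · funext k
      cases k <;> simp
    · funext k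
      cases k <;> simp
    · simp
      omega

/-- The effect of a symbol on the number of formulas still to be read. -/
def pending : Symbol → List Symbol → List Symbol
  | .or, D | .and, D | .imp, D => .one :: D
  | .atom, D | .bot, D => D.tail
  | _, D => D

/-- Move the symbols of a formula from `X` to `T`, counting on `D` the formulas to be read. -/
def readFormula : StackProg Stk Symbol :=
  .loop (fun τ => (τ .D).isSome)
    (.ite (fun τ => τ .X = some .or || τ .X = some .and || τ .X = some .imp) (put .D .one)
      (.ite (fun τ => τ .X = some .atom || τ .X = some .bot) (.pop .D) .skip) ;;
    move .X .T)

theorem runs_readFormula_step {S S' : Stk → List Symbol} {a d : Symbol} {x D : List Symbol}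
    {n : ℕ} (hX : S .X = a :: x) (hD : S .D = d :: D)
    (h : Runs readFormula (update (update (update S .X x) .D (pending a (S .D))) .T (a :: S .T))
      S' n) : Runs readFormula S S' (n + 6) := by
  have r : Runs (.ite (fun τ => τ .X = some .or || τ .X = some .and || τ .X = some .imp)
      (put .D .one) (.ite (fun τ => τ .X = some .atom || τ .X = some .bot) (.pop .D) .skip)) S
      (update S .D (pending a (S .D))) 3 := by
    by_cases h₁ : a = .or ∨ a = .and ∨ a = .imp
    · refine (Runs.ite_true ?_ runs_put).congr ?_ (by omega)
      · simpa [tops, hX, or_assoc] using h₁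
      · rcases h₁ with rfl | rfl | rfl <;> rfl
    · by_cases h₂ : a = .atom ∨ a = .bot
      · refine (Runs.ite_false ?_ (Runs.ite_true ?_ Runs.pop)).congr ?_ (by omega)
        · simpa [tops, hX, and_assoc] using h₁
        · simpa [tops, hX] using h₂
        · rcases h₂ with rfl | rfl <;> rfl
      · refine (Runs.ite_false ?_ (Runs.ite_false ?_ Runs.skip)).congr ?_ (by omega)
        · simpa [tops, hX, and_assoc] using h₁
        · simpa [tops, hX] using h₂
        · have : pending a (S .D) = S .D := by cases a <;> simp_all [pending]
          simp [this]
  have r' := runs_move (S := update S .D (pending a (S .D))) (a := .X) (b := .T) (by decide)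
    (c := a) (l := x) (by simpa using hX)
  refine (Runs.loop_true (by simp [tops, hD]) (r.seq r') (h.congr_start ?_)).congr rfl ?_
  · funext k
    cases k <;> simp
  · omega

/-- Stated with a continuation: `h` is a run of the same loop from the state after `α` has been read
and one pending formula discharged. The two hypotheses for a binary connective then compose without
cutting the loop into pieces. -/
theorem runs_readFormula_code {α : Formula} {S S' : Stk → List Symbol} {d : Symbol}
    {x D : List Symbol} {n : ℕ} (hX : S .X = α.code ++ x) (hD : S .D = d :: D)
    (h : Runs readFormula (update (update (update S .X x) .D D) .T (α.code.reverse ++ S .T))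
      S' n) : Runs readFormula S S' (n + 6 * α.code.length) := by
  have hbin : ∀ (c : Symbol) (β γ : Formula), (∀ D, pending c D = .one :: D) →
      (∀ {S S' : Stk → List Symbol} {d : Symbol} {x D : List Symbol} {n : ℕ},
        S .X = β.code ++ x → S .D = d :: D →
        Runs readFormula (update (update (update S .X x) .D D) .T (β.code.reverse ++ S .T))
          S' n → Runs readFormula S S' (n + 6 * β.code.length)) →
      (∀ {S S' : Stk → List Symbol} {d : Symbol} {x D : List Symbol} {n : ℕ},
        S .X = γ.code ++ x → S .D = d :: D →
        Runs readFormula (update (update (update S .X x) .D D) .T (γ.code.reverse ++ S .T))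
          S' n → Runs readFormula S S' (n + 6 * γ.code.length)) →
      ∀ {S S' : Stk → List Symbol} {d : Symbol} {x D : List Symbol} {n : ℕ},
        S .X = c :: (β.code ++ γ.code) ++ x → S .D = d :: D →
        Runs readFormula (update (update (update S .X x) .D D) .T
          ((c :: (β.code ++ γ.code)).reverse ++ S .T)) S' n →
        Runs readFormula S S' (n + 6 * (c :: (β.code ++ γ.code)).length) := by
    intro c β γ hc hβ hγ S S' d x D n hX hD h
    refine (runs_readFormula_step hX hD (hβ (d := .one) (x := γ.code ++ x) (D := d :: D)
      (by simp) (by simp [hc, hD])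
      (hγ (d := d) (x := x) (D := D) (n := n) (by simp) (by simp)
        (h.congr_start ?_)))).mono ?_
    · funext k
      cases k <;> simp
    · simp
      omega
  induction α generalizing S S' d x D n with
  | atom m =>
    simp only [Formula.code] at hX h ⊢
    generalize m.bits = l at hX h ⊢
    induction l generalizing S with
    | nil =>
      refine (runs_readFormula_step (a := .atom) (x := x) (by simpa using hX) hD
        (h.congr_start ?_)).mono (by simp)
      funext k
      cases k <;> simp [pending, hD]
    | cons b l ih =>
      have hb : ∀ D, pending (Symbol.ofBool b) D = D := fun D => by cases b <;> rfl
      refine (runs_readFormula_step (by simpa using hX) hD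
        (ih ?_ ?_ (h.congr_start ?_))).mono ?_
      · simp [hb, hD]
      · simp
      · funext k
        cases k <;> simp
      · simp
        omega
  | bot =>
    refine (runs_readFormula_step (a := .bot) (x := x) (by simpa [Formula.code] using hX) hD
      (h.congr_start ?_)).mono (by simp [Formula.code])
    funext k
    cases k <;> simp [pending, hD, Formula.code]
  | or β γ ih₀ ih₁ => exact hbin .or β γ (fun _ => rfl) ih₀ ih₁ hX hD h
  | and β γ ih₀ ih₁ => exact hbin .and β γ (fun _ => rfl) ih₀ ih₁ hX hD h
  | imp β γ ih₀ ih₁ => exact hbin .imp β γ (fun _ => rfl) ih₀ ih₁ hX hD h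

theorem runs_readFormula {α : Formula} {S : Stk → List Symbol} {d : Symbol} {x : List Symbol}
    (hX : S .X = α.code ++ x) (hD : S .D = [d]) :
    Runs readFormula S (update (update (update S .X x) .D []) .T (α.code.reverse ++ S .T))
      (6 * α.code.length + 1) :=
  (runs_readFormula_code hX hD (Runs.loop_false (by simp [tops]))).mono (by omega)

/-- Split the disjunction on `X` into its disjuncts on `G₀` and `G₁`. -/
def splitOr : StackProg Stk Symbol :=
  .pop .X ;; put .D .one ;; readFormula ;; moveAll .T .G₀ ;; moveAll .X .T ;; moveAll .T .G₁

theorem runs_splitOr {α β : Formula} {S : Stk → List Symbol} (hX : S .X = (α.or β).code)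
    (hD : S .D = []) (hT : S .T = []) (h₀ : S .G₀ = []) (h₁ : S .G₁ = []) :
    Runs splitOr S (update (update (update S .X []) .G₀ α.code) .G₁ β.code)
      (9 * (S .X).length + 6) := by
  have r₁ := runs_pop (S := S) (a := .X) (c := .or) (l := α.code ++ β.code) hX
  have r₂ := runs_put (S := update S .X (α.code ++ β.code)) (a := .D) (c := .one)
  have r₃ := runs_readFormula (α := α) (d := .one) (x := β.code)
    (S := update (update S .X (α.code ++ β.code)) .D [.one]) (by simp) (by simp)
  refine (r₁.seq (r₂.seq ((r₃.congr_start ?_).seq ((runs_moveAll (by decide)).seq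
    ((runs_moveAll (by decide)).seq (runs_moveAll (by decide))))))).congr ?_ ?_
  · simp [hD]
  · funext k
    cases k <;> simp [hD, hT, h₀, h₁]
  · simp [hX, Formula.code, hT]
    omega

/-- Read the end sequent of the derivation on `W`, and start the clock `N`. -/
def readEnd : StackProg Stk Symbol :=
  copy .W .V .T ;; copy .W .N .T ;; loadAnte .V ;; loadSucc .V ;; clear .V ;; initKnown ;; splitOr

theorem runs_readEnd {r : Symbol} {l : List Formula} {α β : Formula} {z w : List Symbol}
    (hz : Ends z) (hw : w = r :: (itemsCode l ++ .arrow :: ((α.or β).code ++ z))) :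
    Runs readEnd (update (fun _ => []) .W w)
      (update (update (update (update (update (fun _ => []) .W w) .N w) .Y
        (baseCode l.reverse)) .G₀ α.code) .G₁ β.code) (50 * w.length + 30) := by
  have r₁ := runs_copy (S := update (fun _ => []) Stk.W w) (a := .W) (b := .V) (t := .T)
    (by decide) (by decide) (by decide) rfl
  have r₂ := runs_copy (S := update (update (fun _ => []) Stk.W w) .V w) (a := .W) (b := .N)
    (t := .T) (by decide) (by decide) (by decide) rfl
  have r₃ := runs_loadAnte (y := .V)
    (S := update (update (update (fun _ => []) Stk.W w) .V w) .N w) (r := r) (l := l)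
    (z := (α.or β).code ++ z) (by decide) (by decide) (by simp) (by simp) (by simp [hw])
  have r₄ := runs_loadSucc (y := .V) (β := α.or β) (z := z)
    (S := update (update (update (update (fun _ => []) Stk.W w) .N w) .A (itemsCode l)) .V
      ((α.or β).code ++ z)) (by decide) (by decide) (by simp) (by simp) hz (by simp)
  have r₅ := runs_initKnown (l := l) (G := [])
    (S := update (update (update (update (fun _ => []) Stk.W w) .N w) .A (itemsCode l)) .X
      (α.or β).code) (by simp) (by simp [baseCode]) (by simp)
  have r₆ := runs_splitOr (α := α) (β := β)
    (S := update (update (update (update (fun _ => []) Stk.W w) .N w) .Y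
      (baseCode l.reverse)) .X (α.or β).code)
    (by simp) (by simp) (by simp) (by simp) (by simp)
  refine (r₁.seq ((r₂.congr_start ?_).seq ((r₃.congr_start ?_).seq ((r₄.congr_start ?_).seq
    (runs_clear.seq ((r₅.congr_start ?_).seq (r₆.congr_start ?_))))))).congr ?_ ?_
  · funext k
    cases k <;> simp
  · funext k
    cases k <;> simp
  · funext k
    cases k <;> simp
  · funext k
    cases k <;> simp
  · funext k
    cases k <;> simp
  · funext k
    cases k <;> simp
  · have : w.length = 2 + (itemsCode l).length + (α.or β).code.length + z.length := by
      rw [hw]; simp; omega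
    simp
    omega

/-! ### Writing the deduction -/

/-- Put on `I` the answer, if the formula on `X` is one of the formulas on `G₀` and `G₁`. -/
def choose : StackProg Stk Symbol :=
  compare .G₀ ;;
  .ite (fun τ => (τ .F).isSome) (put .I .zero)
    (compare .G₁ ;; .ite (fun τ => (τ .F).isSome) (put .I .one) .skip) ;;
  clear .F

theorem runs_choose {α β γ : Formula} {S : Stk → List Symbol} (hX : S .X = γ.code)
    (h₀ : S .G₀ = α.code) (h₁ : S .G₁ = β.code) (hF : S .F = []) (hP : S .P = [])
    (hI : S .I = []) :
    Runs choose S (update S .I (if γ = α then [.zero] else if γ = β then [.one] else []))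
      (20 * γ.code.length + 20) := by
  have hX' : ∀ a ∈ S .X, a.isFormula = true := by
    rw [hX]; exact fun _ => Formula.isFormula_of_mem_code
  obtain ⟨f, hf, hfl, r₁⟩ := runs_compare (y := .G₀) (by simp [Comparable]) hX' hP
  have hf' : f = [] ↔ γ ≠ α := by
    rw [hf, hX, h₀, ← List.append_nil α.code, isItem_code ends_nil]
    simp [hF]
  suffices H : ∃ f', f'.length ≤ 1 ∧
      Runs (.ite (fun τ => (τ .F).isSome) (put .I .zero)
        (compare .G₁ ;; .ite (fun τ => (τ .F).isSome) (put .I .one) .skip)) (update S .F f)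
        (update (update S .F f') .I
          (if γ = α then [.zero] else if γ = β then [.one] else []))
        (10 * γ.code.length + 8) by
    obtain ⟨f', hfl', r₂⟩ := H
    refine (r₁.seq (r₂.seq runs_clear)).congr ?_ ?_
    · funext k
      cases k <;> simp [hF]
    · simp [hX]
      omega
  by_cases hα : γ = α
  · have hne : f ≠ [] := fun h => hf'.mp h hα
    refine ⟨f, by simpa [hF] using hfl, (Runs.ite_true ?_ runs_put).congr ?_ (by omega)⟩
    · simpa [tops] using hne
    · funext k
      cases k <;> simp [hα, hI]
  · have hfe : f = [] := hf'.mpr hα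
    obtain ⟨g, hg, hgl, r₂⟩ := runs_compare (y := .G₁) (by simp [Comparable]) hX' hP
    have hg' : g = [] ↔ γ ≠ β := by
      rw [hg, hX, h₁, ← List.append_nil β.code, isItem_code ends_nil]
      simp [hF]
    refine ⟨g, by simpa [hF] using hgl, ?_⟩
    have hS : update S .F f = S := by
      funext k
      cases k <;> simp [hfe, hF]
    rw [hS]
    by_cases hβ : γ = β
    · have hne : g ≠ [] := fun h => hg'.mp h hβ
      refine (Runs.ite_false ?_ (r₂.seq (Runs.ite_true ?_ runs_put))).congr ?_ ?_
      · simp [tops, hF]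
      · simpa [tops] using hne
      · simp [hβ, hI]
        simp [← hβ, hα]
      · rw [hX]
    · have hge : g = [] := hg'.mpr hβ
      refine (Runs.ite_false ?_ (r₂.seq (Runs.ite_false ?_ Runs.skip))).congr ?_ ?_
      · simp [tops, hF]
      · simp [tops, hge]
      · funext k
        cases k <;> simp [hα, hβ, hI]
      · rw [hX]

/-- Take the next activated sequent; if it proves a disjunct, start the deduction with it. -/
def startNext : StackProg Stk Symbol :=
  loadAnte .Y ;; loadSucc .Y ;; choose ;;
    .ite (fun τ => (τ .I).isSome) (copy .X .E .T ;; emit .O ;; copy .A .C .T) .skip ;;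
    clear .A ;; clear .X

/-- Take activated sequents until one of them proves a disjunct. -/
def start : StackProg Stk Symbol := .loop (fun τ => (τ .I).isNone) startNext

/-- The stacks used to write the deduction are empty. -/
def Fresh (S : Stk → List Symbol) : Prop := S .I = [] ∧ S .E = [] ∧ S .C = [] ∧ S .O = []

theorem stackCode_cons (G : List Formula) (s : ListSequent) (Y : List ListSequent) :
    stackCode G (s :: Y) =
      .ruleInit :: (itemsCode s.1 ++ .arrow :: (s.2.code ++ stackCode G Y)) := by
  simp [stackCode, ListSequent.code]

theorem length_listSequent_code (s : ListSequent) :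
    s.code.length = (itemsCode s.1).length + 1 + s.2.code.length := by
  simp [ListSequent.code]
  omega

theorem runs_startNext {α β : Formula} {G : List Formula} {s : ListSequent}
    {Y : List ListSequent} {S : Stk → List Symbol} (hS : Clean S) (hS' : Fresh S)
    (h₀ : S .G₀ = α.code) (h₁ : S .G₁ = β.code) (hY : S .Y = stackCode G (s :: Y)) :
    Runs startNext S
      (if s.2 = α ∨ s.2 = β then
        update (update (update (update (update S .Y (stackCode G Y)) .E s.2.code) .C
          (itemsCode s.1)) .O (.ruleInit :: s.code)) .I [if s.2 = α then .zero else .one]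
      else update S .Y (stackCode G Y)) (70 * s.code.length + 50) := by
  obtain ⟨hA, hB, hX, hT, hF, hP, hR, hH⟩ := hS
  obtain ⟨hI, hE, hC, hO⟩ := hS'
  rw [stackCode_cons] at hY
  have hlen := length_listSequent_code s
  have r₁ := runs_loadAnte (y := .Y) (by decide) (by decide) hT hA hY
  have r₂ := runs_loadSucc (y := .Y) (β := s.2) (z := stackCode G Y)
    (S := update (update S .Y (s.2.code ++ stackCode G Y)) .A (itemsCode s.1))
    (by decide) (by decide) (by simpa using hT) (by simpa using hX) (ends_stackCode G Y) (by simp)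
  have r₃ := runs_choose (α := α) (β := β) (γ := s.2)
    (S := update (update (update S .Y (stackCode G Y)) .A (itemsCode s.1)) .X s.2.code)
    (by simp) (by simpa using h₀) (by simpa using h₁) (by simpa using hF) (by simpa using hP)
    (by simpa using hI)
  by_cases hs : s.2 = α ∨ s.2 = β
  · rw [if_pos hs]
    have hi : (if s.2 = α then [.zero] else if s.2 = β then [.one] else []) =
        [if s.2 = α then Symbol.zero else .one] := by
      split_ifs <;> simp_all
    rw [hi] at r₃
    generalize (if s.2 = α then Symbol.zero else .one) = i at r₃ ⊢
    have r₄ := runs_copy (S := update (update (update (update S .Y (stackCode G Y)) .A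
      (itemsCode s.1)) .X s.2.code) .I [i]) (a := .X) (b := .E) (t := .T) (by decide) (by decide)
      (by decide) (by simpa using hT)
    have r₅ := runs_emit (o := .O) (s := s) (S := update (update (update (update (update S .Y
      (stackCode G Y)) .A (itemsCode s.1)) .X s.2.code) .I [i]) .E s.2.code) (by decide)
      (by decide) (by decide) (by simpa using hT) (by simp) (by simp)
    have r₆ := runs_copy (S := update (update (update (update (update (update S .Y
      (stackCode G Y)) .A (itemsCode s.1)) .X s.2.code) .I [i]) .E s.2.code) .O
      (.ruleInit :: s.code)) (a := .A) (b := .C) (t := .T) (by decide) (by decide)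
      (by decide) (by simpa using hT)
    refine (r₁.seq ((r₂.congr_start ?_).seq ((r₃.congr_start ?_).seq ((Runs.ite_true ?_
      (r₄.seq ((r₅.congr_start ?_).seq (r₆.congr_start ?_)))).seq
      (runs_clear.seq runs_clear))))).congr ?_ ?_
    · rfl
    · funext k
      cases k <;> simp
    · simp [tops]
    · simp [hE]
    · simp [hO]
    · funext k
      cases k <;> simp [hA, hX, hC]
    · simp
      omega
  · rw [if_neg hs]
    rw [not_or] at hs
    rw [if_neg hs.1, if_neg hs.2] at r₃
    refine (r₁.seq ((r₂.congr_start ?_).seq ((r₃.congr_start ?_).seq ((Runs.ite_false ?_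
      Runs.skip).seq (runs_clear.seq runs_clear))))).congr ?_ ?_
    · rfl
    · funext k
      cases k <;> simp
    · simp [tops]
    · funext k
      cases k <;> simp [hA, hX, hI]
    · simp
      omega

/-- The factor 122 is 70 + 52: the linear cost of one iteration plus its constant cost, including
the loop tests. The length inequality is kept for the budget of the cutting phase. -/
theorem runs_start {α β : Formula} {G : List Formula} {Y : List ListSequent}
    (h : ∃ y ∈ Y, y.2 = α ∨ y.2 = β) {S : Stk → List Symbol} (hS : Clean S) (hS' : Fresh S)
    (h₀ : S .G₀ = α.code) (h₁ : S .G₁ = β.code) (hY : S .Y = stackCode G Y) :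
    ∃ (i : Symbol) (s : ListSequent) (Y' : List ListSequent),
      extract α β Y = i :: cutAll s.2 Y' s.1 (.ruleInit :: s.code) ∧
      s.code.length + (stackCode G Y').length ≤ (S .Y).length ∧
      Runs start S (update (update (update (update (update S .Y (stackCode G Y')) .E s.2.code) .C
          (itemsCode s.1)) .O (.ruleInit :: s.code)) .I [i])
        ((S .Y).length * 122) := by
  induction Y generalizing S with
  | nil => simp at h
  | cons s Y ih =>
    have hlen : (S .Y).length = s.code.length + 1 + (stackCode G Y).length := by
      rw [hY, stackCode_cons, length_listSequent_code]
      simp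
      omega
    have hpos : 0 < s.code.length := by rw [length_listSequent_code]; omega
    have r := runs_startNext hS hS' h₀ h₁ hY
    have hI : (tops S .I).isNone = true := by simp [tops, hS'.1]
    by_cases hs : s.2 = α ∨ s.2 = β
    · rw [if_pos hs] at r
      refine ⟨if s.2 = α then .zero else .one, s, Y, ?_, by omega,
        (Runs.loop_true hI r (Runs.loop_false ?_)).mono ?_⟩
      · unfold extract
        by_cases hα : s.2 = α
        · simp [hα]
        · have hβ := hs.resolve_left hα
          rw [if_neg hα, if_pos hβ, if_neg hα, hβ]
      · simp [tops]
      · omega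
    · rw [if_neg hs] at r
      obtain ⟨i, t, Y', e₁, e₂, r'⟩ := ih (S := update S .Y (stackCode G Y)) (by
          obtain ⟨y, hy, h⟩ := h
          rcases List.mem_cons.mp hy with rfl | hy
          · exact absurd h hs
          · exact ⟨y, hy, h⟩) (by simpa [Clean] using hS) (by simpa [Fresh] using hS')
        (by simpa using h₀) (by simpa using h₁) (by simp)
      simp only [update_self] at e₂
      refine ⟨i, t, Y', ?_, by omega, (Runs.loop_true hI r r').congr ?_ ?_⟩
      · rw [not_or] at hs
        rw [extract, if_neg hs.1, if_neg hs.2, e₁]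
      · funext k
        cases k <;> simp
      · simp only [update_self]
        omega

/-- Take the next activated sequent; if its succedent is in the antecedent on `C` of the
deduction on `O`, cut it into this deduction, whose succedent is on `E`. -/
def cutNext : StackProg Stk Symbol :=
  loadAnte .Y ;; loadSucc .Y ;; filter ;;
    .ite (fun τ => (τ .H).isSome)
      (emit .O ;; copy .A .C .T ;; copy .E .O .T ;; put .O .arrow ;; copy .C .O .T ;;
        put .O .ruleCut) .skip ;;
    clear .A ;; clear .X ;; clear .H

theorem runs_cutNext {G cur : List Formula} {γ : Formula} {s : ListSequent}
    {Y : List ListSequent} {S : Stk → List Symbol} (hS : Clean S)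
    (hY : S .Y = stackCode G (s :: Y)) (hC : S .C = itemsCode cur) (hE : S .E = γ.code) {n : ℕ}
    (hn : (S .Y).length + (S .C).length ≤ n) (hEn : (S .E).length ≤ n) :
    Runs cutNext S
      (if s.2 ∈ cur then
        update (update (update S .Y (stackCode G Y)) .C
          (itemsCode (s.1 ++ cur.filter (· ≠ s.2)))) .O
          (.ruleCut :: (ListSequent.code (s.1 ++ cur.filter (· ≠ s.2), γ) ++
            .ruleInit :: s.code ++ S .O))
      else update S .Y (stackCode G Y)) (10 * n * n + 100 * n + 50) := by
  obtain ⟨hA, hB, hX, hT, hF, hP, hR, hH⟩ := hS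
  rw [stackCode_cons] at hY
  have hlen := length_listSequent_code s
  have hYl : (S .Y).length = s.code.length + 1 + (stackCode G Y).length := by
    rw [hY, length_listSequent_code]
    simp
    omega
  have hfl : (itemsCode (cur.filter (· ≠ s.2))).length ≤ (itemsCode cur).length :=
    (List.Sublist.flatMap List.filter_sublist _).length_le
  have hcl := length_le_length_itemsCode cur
  have hCn : (S .C).length = (itemsCode cur).length := by rw [hC]
  have r₁ := runs_loadAnte (y := .Y) (by decide) (by decide) hT hA hY
  have r₂ := runs_loadSucc (y := .Y) (β := s.2) (z := stackCode G Y)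
    (S := update (update S .Y (s.2.code ++ stackCode G Y)) .A (itemsCode s.1))
    (by decide) (by decide) (by simpa using hT) (by simpa using hX) (ends_stackCode G Y) (by simp)
  obtain ⟨h, hh, hhl, r₃⟩ := runs_filter (β := s.2) (l := cur)
    (S := update (update (update S .Y (stackCode G Y)) .A (itemsCode s.1)) .X s.2.code)
    (by simpa using hC) (by simp) (by simpa using hF) (by simpa using hP)
    (by simpa using hB) (by simpa using hH)
  have htime : (itemsCode cur).length * (10 * s.2.code.length + 16) ≤ n * (10 * n + 16) :=
    Nat.mul_le_mul (by omega) (by omega)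
  by_cases hs : s.2 ∈ cur
  · rw [if_pos hs]
    have hne : h ≠ [] := fun h' => hh.mp h' hs
    set S₃ := update (update (update (update (update S Stk.Y (stackCode G Y)) .A
      (itemsCode s.1)) .X s.2.code) .C (itemsCode (cur.filter (· ≠ s.2)))) .H h with hS₃
    have r₄ := runs_emit (o := .O) (s := s) (S := S₃) (by decide) (by decide) (by decide)
      (by simpa [hS₃] using hT) (by simp [hS₃]) (by simp [hS₃])
    have r₅ := runs_copy (S := update S₃ .O (.ruleInit :: (s.code ++ S .O))) (a := .A) (b := .C)
      (t := .T) (by decide) (by decide) (by decide) (by simpa [hS₃] using hT)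
    have r₆ := runs_copy (S := update (update S₃ .O (.ruleInit :: (s.code ++ S .O))) .C
      (itemsCode (s.1 ++ cur.filter (· ≠ s.2)))) (a := .E) (b := .O) (t := .T) (by decide)
      (by decide) (by decide) (by simpa [hS₃] using hT)
    have r₇ := runs_copy (S := update (update S₃ .O (.arrow :: (γ.code ++
      .ruleInit :: (s.code ++ S .O)))) .C (itemsCode (s.1 ++ cur.filter (· ≠ s.2))))
      (a := .C) (b := .O) (t := .T) (by decide) (by decide) (by decide)
      (by simpa [hS₃] using hT)
    refine (r₁.seq ((r₂.congr_start ?_).seq ((r₃.congr_start ?_).seq ((Runs.ite_true ?_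
      ((r₄.congr_start ?_).seq ((r₅.congr_start ?_).seq ((r₆.congr_start ?_).seq
      (runs_put.seq ((r₇.congr_start ?_).seq runs_put)))))).seq
      (runs_clear.seq (runs_clear.seq runs_clear)))))).congr ?_ ?_
    · rfl
    · funext k
      cases k <;> simp
    · simpa [tops, hS₃] using hne
    · rfl
    · simp [hS₃]
    · simp [hS₃, itemsCode_append]
    · funext k
      cases k <;> simp [hS₃, hE]
    · funext k
      cases k <;> simp [hS₃, hA, hX, hH, ListSequent.code]
    · simp [hS₃, itemsCode_append] at hfl hhl ⊢
      nlinarith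
  · rw [if_neg hs]
    have hh' : h = [] := hh.mpr hs
    -- The program filters before it knows whether the formula occurs; if it does not, filtering
    -- changes nothing.
    have hfil : cur.filter (· ≠ s.2) = cur := by
      rw [List.filter_eq_self]
      intro a ha
      simp only [ne_eq, decide_eq_true_eq]
      rintro rfl
      exact hs ha
    refine (r₁.seq ((r₂.congr_start ?_).seq ((r₃.congr_start ?_).seq ((Runs.ite_false ?_
      Runs.skip).seq (runs_clear.seq (runs_clear.seq runs_clear)))))).congr ?_ ?_
    · rfl
    · funext k
      cases k <;> simp
    · simp [tops, hh']
    · rw [hfil]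
      funext k
      cases k <;> simp [hA, hX, hH, hC]
    · simp [hh']
      nlinarith

/-- Cut the remaining activated sequents into the deduction. -/
def cutRest : StackProg Stk Symbol := .loop (fun τ => (τ .Y).any Symbol.isRule) cutNext

/-- A cut moves an antecedent from `Y` to `C` and never lengthens the two together, so `n` bounds
every iteration. -/
theorem runs_cutRest {G cur : List Formula} {γ : Formula}
    {Y : List ListSequent} {S : Stk → List Symbol} (hS : Clean S)
    (hY : S .Y = stackCode G Y) (hC : S .C = itemsCode cur) (hE : S .E = γ.code) {n : ℕ}
    (hn : (S .Y).length + (S .C).length ≤ n) (hEn : (S .E).length ≤ n) :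
    ∃ c, c.length ≤ n ∧
      Runs cutRest S
        (update (update (update S .Y (baseCode G)) .C c) .O (cutAll γ Y cur (S .O)))
        ((S .Y).length * (10 * n * n + 100 * n + 51) + 1) := by
  induction Y generalizing S cur with
  | nil =>
    refine ⟨S .C, by omega, (Runs.loop_false ?_).congr ?_ (by simp)⟩
    -- The loop must stop above the formulas of `G`: these begin with an arrow, which is not a rule
    -- name.
    · rw [tops, hY]
      cases G <;> simp [stackCode, baseCode, Symbol.isRule]
    · funext k
      cases k <;> simp [hY, stackCode, cutAll]
  | cons s Y ih =>
    have hYl : (S .Y).length = s.code.length + 1 + (stackCode G Y).length := by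
      rw [hY, stackCode_cons, length_listSequent_code]
      simp
      omega
    have hlen := length_listSequent_code s
    have hrule : (tops S .Y).any Symbol.isRule = true := by
      simp [tops, hY, stackCode_cons, Symbol.isRule]
    have r := runs_cutNext hS hY hC hE hn hEn
    have htime : ∀ m : ℕ, m + 1 ≤ (S .Y).length →
        10 * n * n + 100 * n + 50 + (m * (10 * n * n + 100 * n + 51) + 1) + 1 ≤
          (S .Y).length * (10 * n * n + 100 * n + 51) + 1 := by
      intro m hm
      have := Nat.mul_le_mul_right (10 * n * n + 100 * n + 51) hm
      rw [Nat.succ_mul] at this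
      omega
    by_cases hs : s.2 ∈ cur
    · rw [if_pos hs] at r
      have hfl : (itemsCode (cur.filter (· ≠ s.2))).length ≤ (itemsCode cur).length :=
        (List.Sublist.flatMap List.filter_sublist _).length_le
      have hCn : (S .C).length = (itemsCode cur).length := by rw [hC]
      obtain ⟨c, hc, r'⟩ := ih (cur := s.1 ++ cur.filter (· ≠ s.2))
        (S := update (update (update S .Y (stackCode G Y)) .C
          (itemsCode (s.1 ++ cur.filter (· ≠ s.2)))) .O
          (.ruleCut :: (ListSequent.code (s.1 ++ cur.filter (· ≠ s.2), γ) ++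
            .ruleInit :: s.code ++ S .O))) (by simpa [Clean] using hS) (by simp) (by simp)
        (by simpa using hE)
        (by simp [itemsCode_append] at hfl ⊢; omega) (by simpa using hEn)
      refine ⟨c, hc, (Runs.loop_true hrule r r').congr ?_ (htime _ ?_)⟩
      · rw [cutAll, if_pos hs]
        funext k
        cases k <;> simp
      · simp
        omega
    · rw [if_neg hs] at r
      obtain ⟨c, hc, r'⟩ := ih (cur := cur) (S := update S .Y (stackCode G Y))
        (by simpa [Clean] using hS) (by simp) (by simpa using hC) (by simpa using hE)
        (by simp; omega) (by simpa using hEn)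
      refine ⟨c, hc, (Runs.loop_true hrule r r').congr ?_ (htime _ ?_)⟩
      · rw [cutAll, if_neg hs]
        funext k
        cases k <;> simp
      · simp
        omega

/-! ### Assembling the program and its running time. -/

/-- The whole program. -/
def main : StackProg Stk Symbol :=
  readEnd ;; runPasses ;; start ;; cutRest ;; .push .O (fun τ => (τ .I).getD .zero) ;;
    clear .W ;; clear .Y ;; clear .G₀ ;; clear .G₁ ;; clear .I ;; clear .E ;; clear .C

/-- A polynomial bound for the running time of the program. -/
def mainTime (n : ℕ) : ℕ :=
  (50 * n + 30) + (n * (n * (14 * (n * n + n) + 59) + 5) + 1) + (n * n + n) * 122 +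
    ((n * n + n) * (10 * (n * n + n) * (n * n + n) + 100 * (n * n + n) + 51) + 1) +
    10 * (n * n + n) + 20

theorem runs_main {e : Symbol × ListSequent} {M : List (Symbol × ListSequent)}
    (hM : ∀ x ∈ e :: M, x.1.isRule = true) {α β : Formula} (he : e.2.2 = .or α β)
    {w : List Symbol} (hw : w = (e :: M).flatMap ruleCode)
    (h : ∃ y ∈ passes e.2.1.reverse ((e :: M).map Prod.snd) w.length, y.2 = α ∨ y.2 = β) :
    Runs main (update (fun _ => []) .W w)
      (update (fun _ => []) .O
        (extract α β (passes e.2.1.reverse ((e :: M).map Prod.snd) w.length)))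
      (mainTime w.length) := by
  have hM' : ∀ x ∈ M, x.1.isRule = true := fun x hx => hM x (List.mem_cons_of_mem _ hx)
  have hw' : w = e.1 :: (itemsCode e.2.1 ++ .arrow :: ((α.or β).code ++ M.flatMap ruleCode)) := by
    rw [hw]
    simp [ruleCode, ListSequent.code, he]
  have hwl : w.length = 2 + (itemsCode e.2.1).length + (α.or β).code.length +
      (M.flatMap ruleCode).length := by
    rw [hw']; simp; omega
  -- One arrow per formula replaces one comma, so the bottom of the stack is as long as the written
  -- antecedent, hence at most `n`.
  have hbase : ∀ l : List Formula, (baseCode l.reverse).length = (itemsCode l).length := by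
    intro l
    induction l with
    | nil => rfl
    | cons γ l ih =>
      simp only [baseCode] at ih
      simp [baseCode, ih]
      omega
  have hbl := hbase e.2.1
  have hor : (α.or β).code.length = α.code.length + β.code.length + 1 := by simp [Formula.code]
  set n := w.length with hn
  set G := e.2.1.reverse with hG
  set Y := passes G ((e :: M).map Prod.snd) n with hYdef
  have r₁ := runs_readEnd (ends_flatMap_ruleCode hM') hw'
  rw [← hn, ← hG] at r₁
  set S₁ := update (update (update (update (update (fun _ => []) Stk.W w) .N w) .Y
    (baseCode G)) .G₀ α.code) .G₁ β.code with hS₁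
  have hclean : Clean S₁ := by simp [Clean, hS₁]
  have r₂ := runs_runPasses (G := G) hM (S := S₁) hclean (by simp [hS₁]) (by simpa [hS₁] using hw)
    (Y := []) (by simp [hS₁, stackCode]) (n := n * n + n) (by simp [hS₁, ← hn]; omega)
  have hSN : S₁ .N = w := by simp [hS₁]
  have hSW : S₁ .W = w := by simp [hS₁]
  rw [hSN, hSW, ← hn] at r₂
  -- The clock `N` holds a copy of the input, so exactly `n` passes are made, starting from the
  -- empty list.
  change Runs runPasses S₁ (update (update S₁ Stk.N []) Stk.Y (stackCode G Y)) _ at r₂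
  have hYlen : (stackCode G Y).length ≤ n * n + n := by
    have key : ∀ k, (stackCode G (passes G ((e :: M).map Prod.snd) k)).length ≤
        k * n + (baseCode G).length := by
      intro k
      induction k with
      | zero => simp [passes, stackCode]
      | succ k ih =>
        have := length_stackCode_pass G (e :: M) (passes G ((e :: M).map Prod.snd) k)
        rw [← hw, ← hn] at this
        rw [passes_succ, Nat.succ_mul]
        omega
    have := key n
    rw [← hYdef] at this
    omega
  set S₂ := update (update S₁ Stk.N []) Stk.Y (stackCode G Y) with hS₂
  obtain ⟨i, s, Y', e₁, e₂, r₃⟩ := runs_start h (S := S₂) (G := G)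
    (by simpa [hS₂, Clean] using hclean) (by simp [hS₂, hS₁, Fresh]) (by simp [hS₂, hS₁])
    (by simp [hS₂, hS₁]) (by simp [hS₂])
  have hS₂Y : (S₂ .Y).length ≤ n * n + n := by simpa [hS₂] using hYlen
  have hsl := length_listSequent_code s
  set S₃ := update (update (update (update (update S₂ Stk.Y (stackCode G Y')) .E s.2.code) .C
    (itemsCode s.1)) .O (.ruleInit :: s.code)) .I [i] with hS₃
  obtain ⟨c, hc, r₄⟩ := runs_cutRest (S := S₃) (G := G) (Y := Y') (cur := s.1) (γ := s.2)
    (n := n * n + n) (by simpa [hS₃, hS₂, Clean] using hclean) (by simp [hS₃]) (by simp [hS₃])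
    (by simp [hS₃]) (by simp [hS₃]; omega) (by simp [hS₃]; omega)
  have hS₃Y : (S₃ .Y).length ≤ n * n + n := by simp [hS₃]; omega
  refine (r₁.seq (r₂.seq (r₃.seq (r₄.seq (Runs.push.seq (runs_clear.seq (runs_clear.seq
    (runs_clear.seq (runs_clear.seq (runs_clear.seq (runs_clear.seq
    runs_clear))))))))))).congr ?_ ?_
  · rw [e₁]
    funext k
    cases k <;> simp [hS₃, hS₂, hS₁, tops]
  · have t₁ : (stackCode G Y').length *
        (10 * (n * n + n) * (n * n + n) + 100 * (n * n + n) + 51) ≤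
        (n * n + n) * (10 * (n * n + n) * (n * n + n) + 100 * (n * n + n) + 51) :=
      Nat.mul_le_mul_right _ (by omega)
    simp [hS₃, hS₂, hS₁]
    unfold mainTime
    omega

end StackProg

/-! ### Correctness on written derivations and the polynomial bound. -/

open StackProg

theorem length_lt_length_flatMap_ruleCode (e : Symbol × ListSequent)
    (M : List (Symbol × ListSequent)) :
    (e :: M).length < ((e :: M).flatMap ruleCode).length := by
  -- Each entry contains a rule name and an arrow, so the input length strictly exceeds the number
  -- of sequents, as saturation requires.
  have h : ∀ x : Symbol × ListSequent, 2 ≤ (ruleCode x).length := fun x => by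
    simp [ruleCode, ListSequent.code]
    omega
  have hM : M.length ≤ (M.flatMap ruleCode).length := by
    induction M with
    | nil => simp
    | cons x M ih =>
      have := h x
      simp only [List.length_cons, List.flatMap_cons, List.length_append]
      omega
  have := h e
  simp only [List.length_cons, List.flatMap_cons, List.length_append]
  omega

/-- On every string of a derivation of a disjunction from a Harrop antecedent, the program writes
a disjunct and a cut-deduction of it. -/
theorem Derivation.IsCode.runs_main {Γ : Cedent} {α : Fin 2 → Formula}
    {d : Derivation ⟨Γ, .or (α 0) (α 1)⟩} {w : List Symbol} (h : d.IsCode w)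
    (hΓ : Γ.IsHarrop) :
    ∃ (i : Fin 2) (Γ' : Cedent) (c : CutDeduction d.sequents ⟨Γ', α i⟩) (v : List Symbol),
      Γ' ⊆ Γ ∧ c.IsCode v ∧
        Runs main (update (fun _ => []) .W w)
          (update (fun _ => []) .O (Symbol.ofBool (decide (i = 1)) :: v)) (mainTime w.length) := by
  obtain ⟨e, M, he, hM, hw, hq⟩ := h.exists_list
  have hΓe : e.2.1.toFinset = Γ := congrArg Sequent.ante he
  have hαe : e.2.2 = .or (α 0) (α 1) := congrArg Sequent.succ he
  set L := (e :: M).map Prod.snd with hL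
  set Y := passes e.2.1.reverse L w.length with hY
  have hmem : ∀ q, q ∈ d.sequents ↔ ∃ s ∈ L, s.toSequent = q := by
    intro q
    rw [hq, hL]
    simp only [List.mem_map, exists_exists_and_eq_and]
  have hG : ∀ a, a ∈ e.2.1.reverse ↔ a ∈ Γ := by
    intro a
    rw [← hΓe]
    simp
  have hsat : Saturated e.2.1.reverse L Y := by
    refine saturated_passes ?_
    rw [hL, List.length_map, hw]
    exact length_lt_length_flatMap_ruleCode e M
  have hex := d.exists_disjunct hΓ hG (fun q => (hmem q).mp) hsat
  obtain ⟨i, l, c, v, hl, hc, hv⟩ := extract_correct (S := d.sequents)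
    (fun y hy => (hmem _).mpr ⟨y, passes_subset _ _ _ hy, rfl⟩) (grounded_passes _ _ _) hex
  refine ⟨i, l.toFinset, c, v, fun a ha => ?_, hc, ?_⟩
  · exact (hG a).mp (hl (List.mem_toFinset.mp ha))
  · rw [← hv]
    exact StackProg.runs_main hM hαe hw hex

/-- The time bound as a polynomial. -/
noncomputable def timePolynomial : Polynomial ℕ :=
  let x := Polynomial.X
  let m := x * x + x
  (50 * x + 30) + (x * (x * (14 * m + 59) + 5) + 1) + m * 122 +
    (m * (10 * m * m + 100 * m + 51) + 1) + 10 * m + 20 + 1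

theorem eval_timePolynomial (n : ℕ) : timePolynomial.eval n = mainTime n + 1 := by
  simp [timePolynomial, mainTime]

end NJp

theorem mainTheorem3 :
    ∃ f : {w : List NJp.Symbol // NJp.IsInput w} → List NJp.Symbol,
      Nonempty (Turing.TM2ComputableInPolyTime
        (fun w : {w : List NJp.Symbol // NJp.IsInput w} => (w : List NJp.Symbol)) id f) ∧
      ∀ (Γ : NJp.Cedent) (α : Fin 2 → NJp.Formula)
        (d : NJp.Derivation ⟨Γ, .or (α 0) (α 1)⟩), Γ.IsHarrop →
        ∀ w : {w : List NJp.Symbol // NJp.IsInput w}, d.IsCode (w : List NJp.Symbol) →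
          ∃ (i : Fin 2) (Γ' : NJp.Cedent) (c : NJp.CutDeduction d.sequents ⟨Γ', α i⟩)
            (v : List NJp.Symbol), Γ' ⊆ Γ ∧ c.IsCode v ∧
              f w = NJp.Symbol.ofBool (decide (i = 1)) :: v := by
  have hex : ∀ w : {w : List NJp.Symbol // NJp.IsInput w}, ∃ v,
      NJp.StackProg.Runs NJp.StackProg.main (Function.update (fun _ => []) .W (w : List NJp.Symbol))
      (Function.update (fun _ => []) .O v)
      (NJp.StackProg.mainTime (w : List NJp.Symbol).length) := by
    rintro ⟨w, Γ, α, d, hΓ, hd⟩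
    obtain ⟨i, Γ', c, v, -, -, h⟩ := hd.runs_main hΓ
    exact ⟨_, h⟩
  -- The function is chosen from the strings alone, before any particular derivation is considered.
  choose f hf using hex
  refine ⟨f, ⟨⟨⟨NJp.StackProg.machine NJp.StackProg.main .W .O, Equiv.refl _, Equiv.refl _⟩,
    NJp.timePolynomial, fun w => ?_⟩⟩, ?_⟩
  · have h := (hf w).tm2Outputs
    rw [← NJp.eval_timePolynomial] at h
    have hid : ∀ l : List NJp.Symbol, l.map (Equiv.refl NJp.Symbol).invFun = l :=
      fun l => List.map_id l
    -- The encodings of the alphabets are identities, but mapping along them is only propositionally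
    -- trivial; generalizing both strings allows the transport.
    have h' : ∀ {l v : List NJp.Symbol}, l = w → v = f w → Nonempty
        (Turing.TM2OutputsInTime (NJp.StackProg.machine NJp.StackProg.main .W .O) l (some v)
          (NJp.timePolynomial.eval (w : List NJp.Symbol).length)) := by
      rintro _ _ rfl rfl
      exact h
    exact Classical.choice (h' (hid _) (hid _))
  · intro Γ α d hΓ w hd
    obtain ⟨i, Γ', c, v, hsub, hc, h⟩ := hd.runs_main hΓ
    refine ⟨i, Γ', c, v, hsub, hc, ?_⟩
    -- Both runs start from the same input, so they end with the same stacks; comparing the output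
    -- stack gives the value of `f`.
    simpa using congrFun ((hf w).deterministic h) NJp.Stk.O
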